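/- Let $G_1=(V,E_1)$, $G_2=(V,E_2)$, $G_3=(V,E_3)$ be finite simple planar graphs on the same vertex set $V$, and let $H_{1,2}$ be the graph formed by the edges that lie in both $G_1$ and $G_2$ but not in $G_3$. If $H_{1,2}$ is acyclic and has maximum degree at most $2$, then $\langle G_1,G_2,G_3\rangle$ admits a QuaSEFE; that is, there exist drawings $\Gamma_1,\Gamma_2,\Gamma_3$ of $G_1,G_2,G_3$ in the plane such that each $\Gamma_i$ is quasiplanar (no three edges of $G_i$ pairwise cross in $\Gamma_i$), each vertex of $V$ has the same position in $\Gamma_1$, $\Gamma_2$ and $\Gamma_3$, and each edge shared by two graphs $G_i$ and $G_j$ is represented by the same curve in $\Gamma_i$ and $\Gamma_j$. Here a drawing represents vertices by distinct points and edges by simple arcs between their end vertices that pass through no other vertex, any two edges having only finitely many points in common; two edges cross if they have a common point that is not a vertex. -/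

import Mathlib

/-- The Euclidean plane, in which all graphs are drawn. -/
abbrev Plane : Type := EuclideanSpace ℝ (Fin 2)

/-- `A` is a simple (Jordan) arc with endpoints `p` and `q`: the set of points on some injective
continuous curve from `p` to `q`. -/
def IsArc (p q : Plane) (A : Set Plane) : Prop :=
  ∃ γ : Path p q, Function.Injective γ ∧ Set.range γ = A

/-- A topological drawing of the graph `G` in the plane: the vertices are distinct points, each edge
is a simple arc between its end vertices that passes through no other vertex, and any two edges
have only finitely many points in common. The value of `edge` at pairs that are not edges of `G`
is irrelevant. -/
structure GraphDrawing {V : Type*} (G : SimpleGraph V) where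
  /-- The position of each vertex. -/
  pos : V → Plane
  /-- The set of points on the curve that represents an edge. -/
  edge : Sym2 V → Set Plane
  pos_injective : Function.Injective pos
  isArc_edge : ∀ u v : V, G.Adj u v → IsArc (pos u) (pos v) (edge s(u, v))
  mem_of_pos_mem_edge : ∀ e ∈ G.edgeSet, ∀ w : V, pos w ∈ edge e → w ∈ e
  finite_inter : ∀ e ∈ G.edgeSet, ∀ f ∈ G.edgeSet, e ≠ f → (edge e ∩ edge f).Finite

namespace GraphDrawing

variable {V : Type*} {G : SimpleGraph V}

/-- Two edges cross in a drawing if their curves have a point in common that is not a vertex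
(that is, an interior point of both curves). Touchings count as crossings. -/
def Cross (Γ : GraphDrawing G) (e f : Sym2 V) : Prop :=
  ∃ x : Plane, x ∈ Γ.edge e ∧ x ∈ Γ.edge f ∧ x ∉ Set.range Γ.pos

/-- A drawing is planar if no two distinct edges cross. -/
def IsPlanar (Γ : GraphDrawing G) : Prop :=
  ∀ e ∈ G.edgeSet, ∀ f ∈ G.edgeSet, e ≠ f → ¬ Γ.Cross e f

/-- A drawing is quasiplanar if no three distinct edges pairwise cross. -/
def IsQuasiplanar (Γ : GraphDrawing G) : Prop :=
  ∀ e ∈ G.edgeSet, ∀ f ∈ G.edgeSet, ∀ g ∈ G.edgeSet, e ≠ f → e ≠ g → f ≠ g →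
    ¬ (Γ.Cross e f ∧ Γ.Cross e g ∧ Γ.Cross f g)

end GraphDrawing

/-- A graph is planar if it has a planar drawing. -/
def IsPlanarGraph {V : Type*} (G : SimpleGraph V) : Prop :=
  ∃ Γ : GraphDrawing G, Γ.IsPlanar

/-- The graphs `G i` on the common vertex set `V` admit a QuaSEFE: they have quasiplanar drawings
`Γ i` in which every vertex has the same position in all drawings, and every edge shared by
two of the graphs is the same curve in the two drawings. -/
def AdmitsQuaSEFE {V ι : Type*} (G : ι → SimpleGraph V) : Prop :=
  ∃ Γ : (i : ι) → GraphDrawing (G i),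
    (∀ i, (Γ i).IsQuasiplanar) ∧
    (∀ i j, ∀ v : V, (Γ i).pos v = (Γ j).pos v) ∧
    (∀ i j, ∀ e ∈ (G i).edgeSet ∩ (G j).edgeSet, (Γ i).edge e = (Γ j).edge e)

/-- The graph, on the vertex set `V`, of the edges that lie in `G₁` and in `G₂` but not in `G₃`. -/
abbrev exclusiveCommon {V : Type*} (G₁ G₂ G₃ : SimpleGraph V) : SimpleGraph V :=
  (G₁ ⊓ G₂) \ G₃

/-! ### Arcs -/

/-! Draw `G₃`, `G₁ \ G₃` and `G₂ \ G₃` planarly with the same vertex positions, and let `G₁` and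
`G₂` take their edges in `G₃` from the drawing of `G₃`. Each resulting drawing is a union of at most
two planar ones, so among three edges two come from the same planar drawing and do not cross
(`GraphDrawing.overlay_isQuasiplanar`). What remains is that an edge of F = `exclusiveCommon G₁ G₂
G₃` must be the same curve in the drawings of `G₁ \ G₃` and `G₂ \ G₃`. The components of F are
paths, so they can be laid out as straight segments on the horizontal axis.

`exists_axis_drawing` does this by induction on F: delete the edge at a leaf u with neighbour w,
draw the rest, shrink the curve from w to u towards w by a homeomorphism supported near it
(`PolygonalArc.exists_contraction`), and turn the short remnant into the axis (`exists_straighten`).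
Homeomorphisms preserve planarity, so the other edges need no care. The explicit homeomorphisms need
polygonal curves, which `GraphDrawing.IsPlanar.exists_polygonal` supplies. One axis drawing fixes
the vertex positions; F-neighbours are consecutive in it. `exists_axis_permutation` moves any other
axis drawing to these positions and keeps the edges of F on the axis.

For finite intersections, the drawings of `G₁ \ G₃` and `G₂ \ G₃` are polygonal, while that of `G₃`
is bent (`exists_bending`) so that its edges lie on graphs of polynomials of degree at least two,
which meet each line finitely often. -/

theorem isArc_segment {p q : Plane} (h : p ≠ q) : IsArc p q (segment ℝ p q) :=
  ⟨Path.segment p q, Path.segment_injective_of_ne h, Path.range_segment p q⟩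

theorem IsArc.trans {p c q : Plane} {C D : Set Plane} (hC : IsArc p c C) (hD : IsArc c q D)
    (hCD : C ∩ D ⊆ {c}) : IsArc p q (C ∪ D) := by
  obtain ⟨γ, hγ, rfl⟩ := hC
  obtain ⟨δ, hδ, rfl⟩ := hD
  refine ⟨γ.trans δ, ?_, Path.trans_range γ δ⟩
  have key : ∀ s t : unitInterval, γ s = δ t → s = 1 ∧ t = 0 := by
    intro s t h
    have hc : γ s = c := hCD ⟨⟨s, rfl⟩, ⟨t, h.symm⟩⟩
    exact ⟨hγ (hc.trans γ.target.symm), hδ (h.symm.trans (hc.trans δ.source.symm))⟩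
  intro s t hst
  simp only [Path.trans_apply] at hst
  split_ifs at hst with h1 h2 h2
  · have := congrArg Subtype.val (hγ hst)
    exact Subtype.ext (by simpa using this)
  · have := congrArg Subtype.val (key _ _ hst).2
    simp only [Set.Icc.coe_zero] at this
    exact absurd (by linarith : (t : ℝ) ≤ 1 / 2) h2
  · have := congrArg Subtype.val (key _ _ hst.symm).2
    simp only [Set.Icc.coe_zero] at this
    exact absurd (by linarith : (s : ℝ) ≤ 1 / 2) h1
  · have := congrArg Subtype.val (hδ hst)
    exact Subtype.ext (by simpa using this)

theorem IsArc.symm {p q : Plane} {A : Set Plane} (h : IsArc p q A) : IsArc q p A := by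
  obtain ⟨γ, hγ, rfl⟩ := h
  exact ⟨γ.symm, hγ.comp unitInterval.symm_bijective.1, Path.symm_range γ⟩

theorem IsArc.image (h : Plane ≃ₜ Plane) {p q : Plane} {A : Set Plane} (hA : IsArc p q A) :
    IsArc (h p) (h q) (h '' A) := by
  obtain ⟨γ, hγ, rfl⟩ := hA
  refine ⟨γ.map h.continuous, h.injective.comp hγ, ?_⟩
  rw [← Set.range_comp]
  rfl

theorem IsArc.isCompact {p q : Plane} {A : Set Plane} (h : IsArc p q A) : IsCompact A := by
  obtain ⟨γ, -, rfl⟩ := h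
  exact isCompact_range γ.continuous

theorem IsArc.left_mem {p q : Plane} {A : Set Plane} (h : IsArc p q A) : p ∈ A := by
  obtain ⟨γ, -, rfl⟩ := h
  exact ⟨0, γ.source⟩

theorem IsArc.right_mem {p q : Plane} {A : Set Plane} (h : IsArc p q A) : q ∈ A :=
  h.symm.left_mem

/-! ### Polygonal arcs -/

/-- `PolygonalArc p q C`: the set `C` is a simple polygonal arc from `p` to `q`. -/
inductive PolygonalArc : Plane → Plane → Set Plane → Prop
  | single {p q : Plane} (h : p ≠ q) : PolygonalArc p q (segment ℝ p q)
  | cons {p c q : Plane} {C : Set Plane} (h : p ≠ c) (hC : PolygonalArc c q C)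
      (hd : segment ℝ p c ∩ C ⊆ {c}) : PolygonalArc p q (segment ℝ p c ∪ C)

namespace PolygonalArc

theorem isArc {p q : Plane} {C : Set Plane} (h : PolygonalArc p q C) : IsArc p q C := by
  induction h with
  | single h => exact isArc_segment h
  | cons h _ hd ih => exact (isArc_segment h).trans ih hd

theorem snoc {p c q : Plane} {C : Set Plane} (hC : PolygonalArc p c C) (h : c ≠ q)
    (hd : C ∩ segment ℝ c q ⊆ {c}) : PolygonalArc p q (C ∪ segment ℝ c q) := by
  induction hC with
  | single h' => exact cons h' (single h) hd
  | @cons p b c C h' hC hd' ih =>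
    rw [Set.union_assoc]
    refine cons h' (ih h fun x hx => hd ⟨Or.inr hx.1, hx.2⟩) ?_
    rintro x ⟨hx, hx' | hx'⟩
    · exact hd' ⟨hx, hx'⟩
    · have hxc : x = c := hd ⟨Or.inl hx, hx'⟩
      subst hxc
      exact hd' ⟨hx, hC.isArc.right_mem⟩

theorem symm {p q : Plane} {C : Set Plane} (h : PolygonalArc p q C) : PolygonalArc q p C := by
  induction h with
  | single h => rw [segment_symm]; exact single h.symm
  | @cons p c q C h hC hd ih =>
    rw [Set.union_comm, segment_symm]
    refine ih.snoc h.symm ?_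
    rw [segment_symm, Set.inter_comm]
    exact hd

theorem exists_suffix {p q z : Plane} {C : Set Plane} (h : PolygonalArc p q C) (hz : z ∈ C)
    (hzq : z ≠ q) : ∃ D ⊆ C, PolygonalArc z q D := by
  induction h with
  | @single p q h =>
    exact ⟨_, (convex_segment p q).segment_subset hz (right_mem_segment ℝ p q), single hzq⟩
  | @cons p c q C h hC hd ih =>
    by_cases hzC : z ∈ C
    · obtain ⟨D, hD, hD'⟩ := ih hzC hzq
      exact ⟨D, hD.trans Set.subset_union_right, hD'⟩
    · have hzs : z ∈ segment ℝ p c := hz.resolve_right hzC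
      have hsub := (convex_segment (𝕜 := ℝ) p c).segment_subset hzs (right_mem_segment ℝ p c)
      refine ⟨segment ℝ z c ∪ C, Set.union_subset_union_left _ hsub, cons ?_ hC ?_⟩
      · rintro rfl
        exact hzC hC.isArc.left_mem
      · exact (Set.inter_subset_inter_left _ hsub).trans hd

end PolygonalArc

theorem segment_inter_eq_of_closest {z y c : Plane} {C : Set Plane} (hy : y ∈ segment ℝ z c)
    (hmin : ∀ x ∈ C ∩ segment ℝ z c, dist z y ≤ dist z x) : segment ℝ z y ∩ C ⊆ {y} := by
  rintro x ⟨hx, hxC⟩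
  have h1 := hmin x ⟨hxC, (convex_segment z c).segment_subset (left_mem_segment ℝ z c) hy hx⟩
  have h2 := dist_add_dist_of_mem_segment hx
  have h3 : dist x y = 0 := le_antisymm (by linarith) dist_nonneg
  exact dist_eq_zero.mp h3

/-- `p` equals `q` or is joined to `q` by a polygonal arc inside `U`. -/
def PolygonallyJoined (U : Set Plane) (q p : Plane) : Prop :=
  p = q ∨ ∃ C ⊆ U, PolygonalArc p q C

/-- Prepending the segment may destroy simplicity. Instead, follow it from `z` only to its first
point on the arc, and continue along the arc from there. -/
theorem PolygonallyJoined.extend {U : Set Plane} {q c z : Plane} (h : PolygonallyJoined U q c)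
    (hs : segment ℝ z c ⊆ U) : PolygonallyJoined U q z := by
  by_cases hzq : z = q
  · exact Or.inl hzq
  by_cases hzc : z = c
  · rwa [hzc]
  rcases h with rfl | ⟨C, hCU, hC⟩
  · exact Or.inr ⟨_, hs, PolygonalArc.single hzq⟩
  by_cases hzC : z ∈ C
  · obtain ⟨D, hD, hD'⟩ := hC.exists_suffix hzC hzq
    exact Or.inr ⟨D, hD.trans hCU, hD'⟩
  have hseg : IsCompact (segment ℝ z c) := (isArc_segment hzc).isCompact
  obtain ⟨y, ⟨hyC, hys⟩, hmin⟩ := (hC.isArc.isCompact.inter hseg).exists_isMinOn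
    ⟨c, hC.isArc.left_mem, right_mem_segment ℝ z c⟩
    (f := fun x => dist z x) (by fun_prop)
  have hd := segment_inter_eq_of_closest hys (fun x hx => hmin hx)
  have hzy : z ≠ y := fun h => hzC (h ▸ hyC)
  have hsub : segment ℝ z y ⊆ U :=
    ((convex_segment z c).segment_subset (left_mem_segment ℝ z c) hys).trans hs
  by_cases hyq : y = q
  · subst hyq
    exact Or.inr ⟨_, hsub, PolygonalArc.single hzy⟩
  · obtain ⟨D, hD, hD'⟩ := hC.exists_suffix hyC hyq
    exact Or.inr ⟨_, Set.union_subset hsub (hD.trans hCU), PolygonalArc.cons hzy hD'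
      ((Set.inter_subset_inter_right _ hD).trans hd)⟩

theorem PolygonallyJoined.of_isPreconnected {U A N : Set Plane} {q c z : Plane} (hN : IsOpen N)
    (hNU : N ⊆ U) (hAN : A ⊆ N) (hA : IsPreconnected A) (hc : c ∈ A) (hz : z ∈ A)
    (h : PolygonallyJoined U q c) : PolygonallyJoined U q z := by
  have hball : ∀ x ∈ N, ∃ r > 0, ∀ y ∈ Metric.ball x r, ∀ y' ∈ Metric.ball x r,
      segment ℝ y y' ⊆ U := by
    intro x hx
    obtain ⟨r, hr, hsub⟩ := Metric.isOpen_iff.mp hN x hx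
    exact ⟨r, hr, fun y hy y' hy' => ((convex_ball x r).segment_subset hy hy').trans
      (hsub.trans hNU)⟩
  -- Small balls are convex, so being joined and not being joined to `q` are both open conditions in
  -- `N`; they cannot split `A`.
  have hopen : IsOpen {x | x ∈ N ∧ PolygonallyJoined U q x} := by
    refine Metric.isOpen_iff.mpr fun x hx => ?_
    obtain ⟨r, hr, hs⟩ := hball x hx.1
    obtain ⟨r', hr', hs'⟩ := Metric.isOpen_iff.mp hN x hx.1
    refine ⟨min r r', lt_min hr hr', fun y hy => ⟨hs' ?_, hx.2.extend (hs y ?_ x ?_)⟩⟩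
    · exact Metric.ball_subset_ball (min_le_right _ _) hy
    · exact Metric.ball_subset_ball (min_le_left _ _) hy
    · exact Metric.mem_ball_self hr
  have hopen' : IsOpen {x | x ∈ N ∧ ¬ PolygonallyJoined U q x} := by
    refine Metric.isOpen_iff.mpr fun x hx => ?_
    obtain ⟨r, hr, hs⟩ := hball x hx.1
    obtain ⟨r', hr', hs'⟩ := Metric.isOpen_iff.mp hN x hx.1
    refine ⟨min r r', lt_min hr hr', fun y hy => ⟨hs' ?_, fun hy' =>
      hx.2 (hy'.extend (hs x ?_ y ?_))⟩⟩
    · exact Metric.ball_subset_ball (min_le_right _ _) hy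
    · exact Metric.mem_ball_self hr
    · exact Metric.ball_subset_ball (min_le_left _ _) hy
  by_contra hzn
  obtain ⟨x, -, hx, hx'⟩ := hA _ _ hopen hopen'
    (fun x hx => by
      by_cases hj : PolygonallyJoined U q x
      · exact Or.inl ⟨hAN hx, hj⟩
      · exact Or.inr ⟨hAN hx, hj⟩)
    ⟨c, hc, hAN hc, h⟩ ⟨z, hz, hAN hz, hzn⟩
  exact hx'.2 hx.2

/-! ### Drawings and homeomorphisms -/

namespace GraphDrawing

variable {V : Type*} {G : SimpleGraph V}

/-- The image of a drawing under a homeomorphism of the plane. -/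
def map (Γ : GraphDrawing G) (h : Plane ≃ₜ Plane) : GraphDrawing G where
  pos v := h (Γ.pos v)
  edge e := h '' Γ.edge e
  pos_injective := h.injective.comp Γ.pos_injective
  isArc_edge u v huv := (Γ.isArc_edge u v huv).image h
  mem_of_pos_mem_edge e he w hw := by
    obtain ⟨x, hx, hxw⟩ := hw
    exact Γ.mem_of_pos_mem_edge e he w (h.injective hxw ▸ hx)
  finite_inter e he f hf hef := by
    rw [← Set.image_inter h.injective]
    exact (Γ.finite_inter e he f hf hef).image h

theorem IsPlanar.map {Γ : GraphDrawing G} (hΓ : Γ.IsPlanar) (h : Plane ≃ₜ Plane) :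
    (Γ.map h).IsPlanar := by
  rintro e he f hf hef ⟨_, ⟨x, hx, rfl⟩, ⟨y, hy, hxy⟩, hv⟩
  obtain rfl := h.injective hxy
  exact hΓ e he f hf hef ⟨y, hx, hy, fun ⟨v, hv'⟩ => hv ⟨v, congrArg h hv'⟩⟩

/-- The restriction of a drawing to a subgraph. -/
def restrict {H : SimpleGraph V} (Γ : GraphDrawing G) (hH : H ≤ G) : GraphDrawing H where
  pos := Γ.pos
  edge := Γ.edge
  pos_injective := Γ.pos_injective
  isArc_edge u v huv := Γ.isArc_edge u v (hH huv)
  mem_of_pos_mem_edge e he := Γ.mem_of_pos_mem_edge e (SimpleGraph.edgeSet_mono hH he)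
  finite_inter e he f hf := Γ.finite_inter e (SimpleGraph.edgeSet_mono hH he) f
    (SimpleGraph.edgeSet_mono hH hf)

theorem IsPlanar.restrict {H : SimpleGraph V} {Γ : GraphDrawing G} (hΓ : Γ.IsPlanar)
    (hH : H ≤ G) : (Γ.restrict hH).IsPlanar := fun e he f hf =>
  hΓ e (SimpleGraph.edgeSet_mono hH he) f (SimpleGraph.edgeSet_mono hH hf)

theorem IsPlanar.exists_pos_of_mem {Γ : GraphDrawing G} (hΓ : Γ.IsPlanar) {e f : Sym2 V}
    (he : e ∈ G.edgeSet) (hf : f ∈ G.edgeSet) (hef : e ≠ f) {x : Plane} (hxe : x ∈ Γ.edge e)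
    (hxf : x ∈ Γ.edge f) : ∃ w, w ∈ e ∧ w ∈ f ∧ Γ.pos w = x := by
  by_contra hcon
  refine hΓ e he f hf hef ⟨x, hxe, hxf, ?_⟩
  rintro ⟨w, rfl⟩
  exact hcon ⟨w, Γ.mem_of_pos_mem_edge e he w hxe, Γ.mem_of_pos_mem_edge f hf w hxf, rfl⟩

theorem isCompact_edge (Γ : GraphDrawing G) {e : Sym2 V} (he : e ∈ G.edgeSet) :
    IsCompact (Γ.edge e) := by
  induction e with
  | _ u v => exact (Γ.isArc_edge u v he).isCompact

end GraphDrawing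

theorem IsPlanarGraph.mono {V : Type*} {G H : SimpleGraph V} (hG : IsPlanarGraph G)
    (hH : H ≤ G) : IsPlanarGraph H := by
  obtain ⟨Γ, hΓ⟩ := hG
  exact ⟨Γ.restrict hH, hΓ.restrict hH⟩

/-! ### Replacing the edges of a planar drawing by polygonal arcs -/

theorem segment_inter_sphere_eq {c p x : Plane} {r : ℝ} (hp : dist p c = r)
    (hx : x ∈ segment ℝ c p) (hxr : dist x c = r) : x = p := by
  have := dist_add_dist_of_mem_segment hx
  rw [dist_comm c x, dist_comm c p, hxr, hp] at this
  exact dist_eq_zero.mp (by linarith)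

theorem segment_subset_closedBall_center {c p : Plane} {r : ℝ} (hp : dist p c = r) :
    segment ℝ c p ⊆ Metric.closedBall c r :=
  (convex_closedBall c r).segment_subset (Metric.mem_closedBall_self (hp ▸ dist_nonneg))
    (Metric.mem_closedBall.mpr hp.le)

/-- Two radii of a disk meet only in its centre. -/
theorem radius_inter_radius {c p p' x : Plane} {r : ℝ} (hp : dist p c = r) (hp' : dist p' c = r)
    (hpp : p ≠ p') (hx : x ∈ segment ℝ c p) (hx' : x ∈ segment ℝ c p') : x = c := by
  rw [segment_eq_image_lineMap] at hx hx'
  obtain ⟨s, hs, rfl⟩ := hx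
  obtain ⟨t, ht, hst⟩ := hx'
  have h1 : dist (AffineMap.lineMap c p s) c = s * r := by
    rw [dist_lineMap_left, dist_comm c p, hp, Real.norm_of_nonneg hs.1]
  have h2 : dist (AffineMap.lineMap c p' t) c = t * r := by
    rw [dist_lineMap_left, dist_comm c p', hp', Real.norm_of_nonneg ht.1]
  rw [hst, h1] at h2
  have hr : r ≠ 0 := by
    rintro rfl
    exact hpp ((dist_eq_zero.mp hp).trans (dist_eq_zero.mp hp').symm)
  obtain rfl : s = t := mul_right_cancel₀ hr h2
  by_contra hne
  have hs0 : s ≠ 0 := by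
    rintro rfl
    simp at hne
  apply hpp
  simp only [AffineMap.lineMap_apply, vsub_eq_sub, vadd_eq_add, add_left_inj] at hst
  have := smul_right_injective Plane hs0 hst
  exact (sub_left_injective this).symm

/-- A path that leaves the disk around its start and enters the disk around its end has a middle
part that touches the two disks only in one point each. -/
theorem exists_middle_part {p q : Plane} {r : ℝ} (hr : 0 < r) (hd : Disjoint
    (Metric.closedBall p r) (Metric.closedBall q r)) (γ : Path p q) :
    ∃ A ⊆ Set.range γ, ∃ p' ∈ A, ∃ q' ∈ A, IsCompact A ∧ IsPreconnected A ∧ dist p' p = r ∧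
      dist q' q = r ∧ A ∩ Metric.closedBall p r ⊆ {p'} ∧ A ∩ Metric.closedBall q r ⊆ {q'} := by
  have hγ := γ.continuous
  -- `s` is the last time in the disk around `p`; below, `t` is the first later time in the disk
  -- around `q`.
  obtain ⟨s, hs, hsmax⟩ := ((Metric.isClosed_closedBall (x := p) (ε := r)).preimage
    hγ).isCompact.exists_isMaxOn ⟨0, by simp [hr.le]⟩ continuousOn_id
  have hsmax' : ∀ t, s < t → r < dist (γ t) p := fun t ht => by
    by_contra hcon
    exact absurd (hsmax (Metric.mem_closedBall.mpr (not_lt.mp hcon))) (not_le.mpr ht)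
  have hsq : γ s ∉ Metric.closedBall q r := Set.disjoint_left.mp hd hs
  obtain ⟨t, ⟨ht, hst⟩, htmin⟩ := (((Metric.isClosed_closedBall (x := q) (ε := r)).preimage
    hγ).inter (isClosed_Ici (a := s))).isCompact.exists_isMinOn
      ⟨1, by simp [hr.le], unitInterval.le_one s⟩ continuousOn_id
  have htmin' : ∀ u, s ≤ u → u < t → r < dist (γ u) q := fun u hu hut => by
    by_contra hcon
    exact absurd (htmin ⟨Metric.mem_closedBall.mpr (not_lt.mp hcon), hu⟩) (not_le.mpr hut)
  have hst' : s < t := lt_of_le_of_ne hst fun h => hsq (h ▸ ht)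
  have hsd : dist (γ s) p = r := by
    refine le_antisymm (Metric.mem_closedBall.mp hs) ?_
    have hcl : s ∈ closure (Set.Ioi s) := by
      rw [closure_Ioi' ⟨t, hst'⟩]
      exact Set.self_mem_Ici
    have : Set.Ioi s ⊆ {u | r ≤ dist (γ u) p} := fun u hu => (hsmax' u hu).le
    exact closure_minimal this (isClosed_le continuous_const (by fun_prop)) hcl
  have htd : dist (γ t) q = r := by
    refine le_antisymm (Metric.mem_closedBall.mp ht) ?_
    have hcl : t ∈ closure (Set.Ico s t) := by
      rw [closure_Ico hst'.ne]
      exact ⟨hst, le_rfl⟩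
    have : Set.Ico s t ⊆ {u | r ≤ dist (γ u) q} := fun u hu => (htmin' u hu.1 hu.2).le
    exact closure_minimal this (isClosed_le continuous_const (by fun_prop)) hcl
  refine ⟨γ '' Set.Icc s t, Set.image_subset_range _ _, γ s, ⟨s, ⟨le_rfl, hst⟩, rfl⟩, γ t,
    ⟨t, ⟨hst, le_rfl⟩, rfl⟩, isCompact_Icc.image hγ,
    (isPreconnected_Icc).image _ hγ.continuousOn, hsd, htd, ?_, ?_⟩
  · rintro _ ⟨⟨u, hu, rfl⟩, hu'⟩
    rcases hu.1.eq_or_lt with rfl | h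
    · rfl
    · exact absurd (hsmax' u h) (not_lt.mpr hu')
  · rintro _ ⟨⟨u, hu, rfl⟩, hu'⟩
    rcases hu.2.eq_or_lt with rfl | h
    · rfl
    · exact absurd (htmin' u hu.1 h) (not_lt.mpr hu')

/-- The middle part of a segment. -/
theorem exists_middle_part_segment {p q : Plane} {r : ℝ} (hr : 0 < r) (hd : Disjoint
    (Metric.closedBall p r) (Metric.closedBall q r)) :
    ∃ A ⊆ segment ℝ p q, ∃ p' ∈ A, ∃ q' ∈ A, IsCompact A ∧ IsPreconnected A ∧ dist p' p = r ∧
      dist q' q = r ∧ A ∩ Metric.closedBall p r ⊆ {p'} ∧ A ∩ Metric.closedBall q r ⊆ {q'} ∧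
      segment ℝ p q ⊆ segment ℝ p p' ∪ A ∪ segment ℝ q q' := by
  have hne : p ≠ q := by
    rintro rfl
    exact Set.disjoint_left.mp hd (Metric.mem_closedBall_self hr.le)
      (Metric.mem_closedBall_self hr.le)
  have hD : 0 < dist p q := dist_pos.mpr hne
  have h2r : 2 * r < dist p q := by
    by_contra hcon
    push Not at hcon
    have h1 : midpoint ℝ p q ∈ Metric.closedBall p r := by
      rw [Metric.mem_closedBall, dist_midpoint_left, Real.norm_of_nonneg zero_le_two]
      linarith
    have h2 : midpoint ℝ p q ∈ Metric.closedBall q r := by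
      rw [Metric.mem_closedBall, dist_midpoint_right, Real.norm_of_nonneg zero_le_two]
      linarith
    exact Set.disjoint_left.mp hd h1 h2
  set s := r / dist p q with hs
  have hsD : s * dist p q = r := div_mul_cancel₀ _ hD.ne'
  have hs0 : 0 < s := div_pos hr hD
  have hs1 : 2 * s < 1 := by
    by_contra hcon
    push Not at hcon
    nlinarith
  have hcont : Continuous fun t : ℝ => (AffineMap.lineMap p q t : Plane) :=
    AffineMap.lineMap_continuous
  refine ⟨(fun t : ℝ => AffineMap.lineMap p q t) '' Set.Icc s (1 - s), ?_,
    AffineMap.lineMap p q s, ⟨s, ⟨le_rfl, by linarith⟩, rfl⟩,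
    AffineMap.lineMap p q (1 - s), ⟨1 - s, ⟨by linarith, le_rfl⟩, rfl⟩,
    isCompact_Icc.image hcont, isPreconnected_Icc.image _ hcont.continuousOn, ?_, ?_, ?_, ?_, ?_⟩
  · rw [segment_eq_image_lineMap]
    exact Set.image_mono (Set.Icc_subset_Icc hs0.le (by linarith))
  · rw [dist_lineMap_left, Real.norm_of_nonneg hs0.le, hsD]
  · rw [dist_lineMap_right, sub_sub_cancel, Real.norm_of_nonneg hs0.le, hsD]
  · rintro _ ⟨⟨t, ht, rfl⟩, ht'⟩
    simp only [Metric.mem_closedBall, dist_lineMap_left] at ht'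
    rw [Real.norm_of_nonneg (hs0.le.trans ht.1), ← hsD] at ht'
    rw [le_antisymm (le_of_mul_le_mul_right ht' hD) ht.1]
    rfl
  · rintro _ ⟨⟨t, ht, rfl⟩, ht'⟩
    simp only [Metric.mem_closedBall, dist_lineMap_right] at ht'
    rw [Real.norm_of_nonneg (by linarith [ht.2]), ← hsD] at ht'
    have := le_of_mul_le_mul_right ht' hD
    rw [le_antisymm ht.2 (by linarith)]
    rfl
  · rw [segment_eq_image_lineMap]
    rintro _ ⟨t, ht, rfl⟩
    rcases lt_or_ge t s with h1 | h1
    · refine Or.inl (Or.inl ?_)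
      rw [segment_eq_image_lineMap]
      refine ⟨t / s, ⟨div_nonneg ht.1 hs0.le, (div_le_one hs0).mpr h1.le⟩, ?_⟩
      rw [AffineMap.lineMap_lineMap_right, div_mul_cancel₀ _ hs0.ne']
    rcases lt_or_ge (1 - s) t with h2 | h2
    · refine Or.inr ?_
      rw [segment_eq_image_lineMap]
      refine ⟨(1 - t) / s, ⟨div_nonneg (by linarith [ht.2]) hs0.le,
        (div_le_one hs0).mpr (by linarith)⟩, ?_⟩
      rw [AffineMap.lineMap_apply_one_sub, AffineMap.lineMap_lineMap_right,
        div_mul_cancel₀ _ hs0.ne', AffineMap.lineMap_apply_one_sub]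
    · exact Or.inl (Or.inr ⟨t, ⟨h1, h2⟩, rfl⟩)

namespace GraphDrawing

variable {V : Type*} {G : SimpleGraph V}

/-- A radius around each vertex such that the disks are disjoint and meet only the incident
edges. -/
theorem exists_vertex_radius [Finite V] (Γ : GraphDrawing G) : ∃ r > 0,
    (∀ v w, v ≠ w → Disjoint (Metric.closedBall (Γ.pos v) r) (Metric.closedBall (Γ.pos w) r)) ∧
    ∀ v, ∀ e ∈ G.edgeSet, v ∉ e → Disjoint (Metric.closedBall (Γ.pos v) r) (Γ.edge e) := by
  have h1 : ∀ᶠ r in nhdsWithin (0 : ℝ) (Set.Ioi 0), ∀ v w, v ≠ w →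
      Disjoint (Metric.closedBall (Γ.pos v) r) (Metric.closedBall (Γ.pos w) r) := by
    simp only [Filter.eventually_all]
    intro v w hvw
    have hd : 0 < dist (Γ.pos v) (Γ.pos w) := dist_pos.mpr (Γ.pos_injective.ne hvw)
    filter_upwards [Ioo_mem_nhdsGT (half_pos hd)] with r hr
    exact Metric.closedBall_disjoint_closedBall (by linarith [hr.2])
  have h2 : ∀ᶠ r in nhdsWithin (0 : ℝ) (Set.Ioi 0), ∀ v, ∀ e, e ∈ G.edgeSet → v ∉ e →
      Disjoint (Metric.closedBall (Γ.pos v) r) (Γ.edge e) := by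
    simp only [Filter.eventually_all]
    intro v e he hve
    have hmem : Γ.pos v ∈ (Γ.edge e)ᶜ := fun h => hve (Γ.mem_of_pos_mem_edge e he v h)
    obtain ⟨ε, hε, hsub⟩ := Metric.isOpen_iff.mp (Γ.isCompact_edge he).isClosed.isOpen_compl _ hmem
    filter_upwards [Ioo_mem_nhdsGT hε] with r hr
    exact Set.disjoint_left.mpr fun x hx hx' => hsub (Metric.closedBall_subset_ball hr.2 hx) hx'
  obtain ⟨r, ⟨hr1, hr2⟩, hr⟩ := ((h1.and h2).and self_mem_nhdsWithin).exists
  exact ⟨r, hr, hr1, hr2⟩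

/-- The edges of a planar drawing have neighbourhoods that meet only in common end vertices. -/
theorem IsPlanar.exists_neighbourhoods [Finite V] {Γ : GraphDrawing G} (hΓ : Γ.IsPlanar) :
    ∃ U : Sym2 V → Set Plane,
      (∀ e ∈ G.edgeSet, ∀ f ∈ G.edgeSet, e ≠ f → U e ∩ U f ⊆ Γ.pos '' {w | w ∈ e ∧ w ∈ f}) ∧
      (∀ e ∈ G.edgeSet, ∀ w, Γ.pos w ∈ U e → w ∈ e) ∧
      (∀ u v, G.Adj u v → PolygonallyJoined (U s(u, v)) (Γ.pos v) (Γ.pos u)) ∧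
      (∀ u v, G.Adj u v → Γ.edge s(u, v) = segment ℝ (Γ.pos u) (Γ.pos v) →
        Γ.edge s(u, v) ⊆ U s(u, v)) := by
  classical
  obtain ⟨r, hr, hrv, hre⟩ := Γ.exists_vertex_radius
  -- Each edge keeps a middle part `A` between the disks, ending at points `p w` on the circles. The
  -- last clause ensures that a straight edge is covered by `A` and the radii to these points, so it
  -- can survive unchanged.
  have hmid : ∀ e : Sym2 V, ∃ (A : Set Plane) (p : V → Plane), e ∈ G.edgeSet →
      A ⊆ Γ.edge e ∧ IsCompact A ∧ IsPreconnected A ∧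
      (∀ w ∈ e, p w ∈ A ∧ dist (p w) (Γ.pos w) = r ∧
        A ∩ Metric.closedBall (Γ.pos w) r ⊆ {p w}) ∧
      (∀ u v, e = s(u, v) → Γ.edge e = segment ℝ (Γ.pos u) (Γ.pos v) →
        Γ.edge e ⊆ A ∪ ⋃ w ∈ e, segment ℝ (Γ.pos w) (p w)) := by
    intro e
    induction e with
    | _ u v =>
    by_cases he : G.Adj u v
    swap
    · exact ⟨∅, Γ.pos, fun h => absurd h he⟩
    by_cases hseg : Γ.edge s(u, v) = segment ℝ (Γ.pos u) (Γ.pos v)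
    · obtain ⟨A, hA, p, hp, q, hq, h1, h2, h3, h4, h5, h6, h7⟩ :=
        exists_middle_part_segment hr (hrv u v he.ne)
      refine ⟨A, fun w => if w = u then p else q, fun _ => ⟨hseg ▸ hA, h1, h2, ?_, ?_⟩⟩
      · intro w hw
        rcases Sym2.mem_iff.mp hw with rfl | rfl
        · simpa only [↓reduceIte] using ⟨hp, h3, h5⟩
        · simpa only [if_neg he.ne'] using ⟨hq, h4, h6⟩
      · intro _ _ _ _
        rw [hseg]
        refine h7.trans ?_
        rintro x ((hx | hx) | hx)
        · refine Or.inr (Set.mem_biUnion (x := u) (Sym2.mem_mk_left u v) ?_)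
          simpa using hx
        · exact Or.inl hx
        · refine Or.inr (Set.mem_biUnion (x := v) (Sym2.mem_mk_right u v) ?_)
          simpa [he.ne'] using hx
    · obtain ⟨γ, -, hγ⟩ := Γ.isArc_edge u v he
      obtain ⟨A, hA, p, hp, q, hq, h1, h2, h3, h4, h5, h6⟩ :=
        exists_middle_part hr (hrv u v he.ne) γ
      refine ⟨A, fun w => if w = u then p else q, fun _ => ⟨hγ ▸ hA, h1, h2, ?_, ?_⟩⟩
      · intro w hw
        rcases Sym2.mem_iff.mp hw with rfl | rfl
        · simpa only [↓reduceIte] using ⟨hp, h3, h5⟩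
        · simpa only [if_neg he.ne'] using ⟨hq, h4, h6⟩
      · intro a b hab hseg'
        rcases Sym2.eq_iff.mp hab with ⟨rfl, rfl⟩ | ⟨rfl, rfl⟩
        · exact absurd hseg' hseg
        · exact absurd (hseg'.trans (segment_symm _ _ _)) hseg
  choose A p hA using hmid
  have hvA : ∀ e ∈ G.edgeSet, ∀ w, Γ.pos w ∉ A e := by
    intro e he w hw
    have hwe := Γ.mem_of_pos_mem_edge e he w ((hA e he).1 hw)
    obtain ⟨-, h1, h2⟩ := (hA e he).2.2.2.1 w hwe
    have : Γ.pos w = p e w := h2 ⟨hw, Metric.mem_closedBall_self hr.le⟩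
    rw [← this, dist_self] at h1
    exact hr.ne h1
  have hAA : ∀ e ∈ G.edgeSet, ∀ f ∈ G.edgeSet, e ≠ f → Disjoint (A e) (A f) := by
    intro e he f hf hef
    refine Set.disjoint_left.mpr fun x hxe hxf => ?_
    obtain ⟨w, -, -, rfl⟩ := hΓ.exists_pos_of_mem he hf hef ((hA e he).1 hxe) ((hA f hf).1 hxf)
    exact hvA e he w hxe
  -- Inside the disks, edges are replaced by radii. Distinct edges reach a circle at distinct
  -- points, so their radii meet only in the centre.
  set Z : Sym2 V → Set Plane := fun e => ⋃ w ∈ e, segment ℝ (Γ.pos w) (p e w) with hZ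
  have hZc : ∀ e, IsClosed (Z e) := fun e => by
    refine Set.Finite.isClosed_biUnion (Set.toFinite {w | w ∈ e}) fun w _ => ?_
    rw [← Path.range_segment]
    exact (isCompact_range (Path.segment _ _).continuous).isClosed
  have hAZ : ∀ e ∈ G.edgeSet, ∀ f ∈ G.edgeSet, e ≠ f → Disjoint (A e) (Z f) := by
    intro e he f hf hef
    refine Set.disjoint_left.mpr fun x hxe hxf => ?_
    obtain ⟨w, hw, hxw⟩ := Set.mem_iUnion₂.mp hxf
    obtain ⟨hfw, h1, -⟩ := (hA f hf).2.2.2.1 w hw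
    have hxb := segment_subset_closedBall_center h1 hxw
    by_cases hwe : w ∈ e
    · obtain ⟨hew, h2, h3⟩ := (hA e he).2.2.2.1 w hwe
      obtain rfl : x = p e w := h3 ⟨hxe, hxb⟩
      have := segment_inter_sphere_eq h1 hxw h2
      exact Set.disjoint_left.mp (hAA e he f hf hef) hew (this ▸ hfw)
    · exact Set.disjoint_left.mp (hre w e he hwe) hxb ((hA e he).1 hxe)
  have hthick : ∀ e : Sym2 V, ∃ δ : ℝ, 0 < δ ∧ (e ∈ G.edgeSet →
      Disjoint (Metric.thickening δ (A e)) (Metric.thickening δ (Set.range Γ.pos ∪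
        ⋃ f ∈ {f | f ∈ G.edgeSet ∧ e ≠ f}, (A f ∪ Z f)))) := by
    intro e
    by_cases he : e ∈ G.edgeSet
    swap
    · exact ⟨1, one_pos, fun h => absurd h he⟩
    have hd : Disjoint (A e) (Set.range Γ.pos ∪
        ⋃ f ∈ {f | f ∈ G.edgeSet ∧ e ≠ f}, (A f ∪ Z f)) := by
      refine Set.disjoint_union_right.mpr ⟨?_, ?_⟩
      · refine Set.disjoint_right.mpr ?_
        rintro _ ⟨w, rfl⟩
        exact hvA e he w
      · refine Set.disjoint_iUnion₂_right.mpr fun f hf => Set.disjoint_union_right.mpr ⟨?_, ?_⟩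
        · exact hAA e he f hf.1 hf.2
        · exact hAZ e he f hf.1 hf.2
    obtain ⟨δ, hδ, hδ'⟩ := hd.exists_thickenings (hA e he).2.1
      ((Set.finite_range _).isClosed.union (Set.Finite.isClosed_biUnion (Set.toFinite _)
        fun f hf => (hA f hf.1).2.1.isClosed.union (hZc f)))
    exact ⟨δ, hδ, fun _ => hδ'⟩
  choose δ hδ hδd using hthick
  have hTpos : ∀ e ∈ G.edgeSet, ∀ w, Γ.pos w ∉ Metric.thickening (δ e) (A e) := by
    intro e he w hw
    exact Set.disjoint_left.mp (hδd e he) hw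
      (Metric.self_subset_thickening (hδ e) _ (Or.inl ⟨w, rfl⟩))
  have hTZ : ∀ e ∈ G.edgeSet, ∀ f ∈ G.edgeSet, e ≠ f → ∀ x ∈ Metric.thickening (δ e) (A e),
      x ∉ Z f := by
    intro e he f hf hef x hx hxf
    exact Set.disjoint_left.mp (hδd e he) hx (Metric.self_subset_thickening (hδ e) _
      (Or.inr (Set.mem_biUnion (x := f) ⟨hf, hef⟩ (Or.inr hxf))))
  -- The widths `δ` vary with the edge. The separation chosen for the larger width also covers the
  -- smaller one.
  have hTT : ∀ e ∈ G.edgeSet, ∀ f ∈ G.edgeSet, e ≠ f → δ f ≤ δ e →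
      ∀ x ∈ Metric.thickening (δ e) (A e), x ∉ Metric.thickening (δ f) (A f) := by
    intro e he f hf hef hle x hx hxf
    refine Set.disjoint_left.mp (hδd e he) hx (Metric.thickening_subset_of_subset _ ?_
      (Metric.thickening_mono hle _ hxf))
    exact fun y hy => Or.inr (Set.mem_biUnion (x := f) ⟨hf, hef⟩ (Or.inl hy))
  have hZZ : ∀ e ∈ G.edgeSet, ∀ f ∈ G.edgeSet, e ≠ f → Z e ∩ Z f ⊆
      Γ.pos '' {w | w ∈ e ∧ w ∈ f} := by
    rintro e he f hf hef x ⟨hxe, hxf⟩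
    obtain ⟨v, hv, hxv⟩ := Set.mem_iUnion₂.mp hxe
    obtain ⟨w, hw, hxw⟩ := Set.mem_iUnion₂.mp hxf
    obtain ⟨hve, h1, -⟩ := (hA e he).2.2.2.1 v hv
    obtain ⟨hwf, h2, -⟩ := (hA f hf).2.2.2.1 w hw
    by_cases hvw : v = w
    · subst hvw
      refine ⟨v, ⟨hv, hw⟩, (radius_inter_radius h1 h2 ?_ hxv hxw).symm⟩
      intro h
      exact Set.disjoint_left.mp (hAA e he f hf hef) hve (h ▸ hwf)
    · exact absurd (segment_subset_closedBall_center h2 hxw)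
        (Set.disjoint_left.mp (hrv v w hvw) (segment_subset_closedBall_center h1 hxv))
  refine ⟨fun e => Metric.thickening (δ e) (A e) ∪ Z e, ?_, ?_, ?_, ?_⟩
  · rintro e he f hf hef x ⟨hxe | hxe, hxf | hxf⟩
    · rcases le_total (δ f) (δ e) with h | h
      · exact absurd hxf (hTT e he f hf hef h x hxe)
      · exact absurd hxe (hTT f hf e he hef.symm h x hxf)
    · exact absurd hxf (hTZ e he f hf hef x hxe)
    · exact absurd hxe (hTZ f hf e he hef.symm x hxf)
    · exact hZZ e he f hf hef ⟨hxe, hxf⟩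
  · rintro e he w (hw | hw)
    · exact absurd hw (hTpos e he w)
    · obtain ⟨v, hv, hwv⟩ := Set.mem_iUnion₂.mp hw
      obtain ⟨-, h1, -⟩ := (hA e he).2.2.2.1 v hv
      by_contra hwe
      have hvw : v ≠ w := fun h => hwe (h ▸ hv)
      exact Set.disjoint_left.mp (hrv v w hvw) (segment_subset_closedBall_center h1 hwv)
        (Metric.mem_closedBall_self hr.le)
  · intro u v huv
    have hZsub : ∀ w ∈ s(u, v), segment ℝ (Γ.pos w) (p s(u, v) w) ⊆
        Metric.thickening (δ s(u, v)) (A s(u, v)) ∪ Z s(u, v) := fun w hw x hx =>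
      Or.inr (Set.mem_biUnion (x := w) hw hx)
    have hu := Sym2.mem_mk_left u v
    have hv := Sym2.mem_mk_right u v
    have hE := hA s(u, v) huv
    have h0 : PolygonallyJoined (Metric.thickening (δ s(u, v)) (A s(u, v)) ∪ Z s(u, v))
        (Γ.pos v) (Γ.pos v) := Or.inl rfl
    have h1 := h0.extend (z := p s(u, v) v) (by rw [segment_symm]; exact hZsub v hv)
    have h2 := h1.of_isPreconnected Metric.isOpen_thickening Set.subset_union_left
      (Metric.self_subset_thickening (hδ _) _) hE.2.2.1 (hE.2.2.2.1 v hv).1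
      (hE.2.2.2.1 u hu).1
    exact h2.extend (hZsub u hu)
  · intro u v huv hseg
    refine ((hA s(u, v) huv).2.2.2.2 u v rfl hseg).trans (Set.union_subset_union_left _ ?_)
    exact Metric.self_subset_thickening (hδ _) _

/-- Every planar drawing can be made polygonal, without moving the vertices and without changing
a given set of straight edges. -/
theorem IsPlanar.exists_polygonal [Finite V] {Γ : GraphDrawing G} (hΓ : Γ.IsPlanar)
    {F : SimpleGraph V}
    (hseg : ∀ u v, F.Adj u v → Γ.edge s(u, v) = segment ℝ (Γ.pos u) (Γ.pos v)) :
    ∃ Γ' : GraphDrawing G, Γ'.IsPlanar ∧ Γ'.pos = Γ.pos ∧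
      (∀ u v, F.Adj u v → Γ'.edge s(u, v) = segment ℝ (Γ.pos u) (Γ.pos v)) ∧
      ∀ u v, G.Adj u v → PolygonalArc (Γ.pos u) (Γ.pos v) (Γ'.edge s(u, v)) := by
  classical
  obtain ⟨U, hUU, hUw, hUj, hUs⟩ := hΓ.exists_neighbourhoods
  have hC : ∀ e : Sym2 V, ∃ C : Set Plane,
      (e ∈ G.edgeSet → C ⊆ U e) ∧
      (∀ u v, e = s(u, v) → F.Adj u v → C = segment ℝ (Γ.pos u) (Γ.pos v)) ∧
      (∀ u v, e = s(u, v) → G.Adj u v → PolygonalArc (Γ.pos u) (Γ.pos v) C) := by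
    intro e
    induction e with
    | _ u v =>
    by_cases hF : F.Adj u v
    · refine ⟨segment ℝ (Γ.pos u) (Γ.pos v), fun he => ?_, ?_, ?_⟩
      · rw [← hseg u v hF]
        exact hUs u v he (hseg u v hF)
      · intro a b hab _
        rcases Sym2.eq_iff.mp hab with ⟨rfl, rfl⟩ | ⟨rfl, rfl⟩
        · rfl
        · exact segment_symm _ _ _
      · intro a b hab hab'
        rcases Sym2.eq_iff.mp hab with ⟨rfl, rfl⟩ | ⟨rfl, rfl⟩
        · exact .single (Γ.pos_injective.ne hab'.ne)
        · rw [segment_symm]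
          exact .single (Γ.pos_injective.ne hab'.ne)
    · have hF' : ∀ a b, s(u, v) = s(a, b) → ¬ F.Adj a b := by
        intro a b hab
        rcases Sym2.eq_iff.mp hab with ⟨rfl, rfl⟩ | ⟨rfl, rfl⟩
        · exact hF
        · exact fun h => hF h.symm
      by_cases hG : G.Adj u v
      · obtain ⟨C, hCU, hC⟩ := (hUj u v hG).resolve_left (Γ.pos_injective.ne hG.ne)
        refine ⟨C, fun _ => hCU, fun a b hab h => absurd h (hF' a b hab), fun a b hab _ => ?_⟩
        rcases Sym2.eq_iff.mp hab with ⟨rfl, rfl⟩ | ⟨rfl, rfl⟩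
        · exact hC
        · exact hC.symm
      · refine ⟨∅, fun h => absurd h hG, fun a b hab h => absurd h (hF' a b hab),
          fun a b hab h => absurd ?_ hG⟩
        rcases Sym2.eq_iff.mp hab with ⟨rfl, rfl⟩ | ⟨rfl, rfl⟩
        · exact h
        · exact h.symm
  choose C hCU hCF hCG using hC
  have hinter : ∀ e ∈ G.edgeSet, ∀ f ∈ G.edgeSet, e ≠ f → C e ∩ C f ⊆ Set.range Γ.pos :=
    fun e he f hf hef => ((Set.inter_subset_inter (hCU e he) (hCU f hf)).trans
      (hUU e he f hf hef)).trans (Set.image_subset_range _ _)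
  refine ⟨{ pos := Γ.pos
            edge := C
            pos_injective := Γ.pos_injective
            isArc_edge := fun u v huv => (hCG _ u v rfl huv).isArc
            mem_of_pos_mem_edge := fun e he w hw => hUw e he w (hCU e he hw)
            finite_inter := fun e he f hf hef =>
              (Set.finite_range Γ.pos).subset (hinter e he f hf hef) }, ?_, rfl,
    fun u v => hCF _ u v rfl, fun u v => hCG _ u v rfl⟩
  rintro e he f hf hef ⟨x, hxe, hxf, hx⟩
  exact hx (hinter e he f hf hef ⟨hxe, hxf⟩)

end GraphDrawing

/-! ### Homeomorphisms of the plane that shorten and straighten arcs -/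

/-- On a segment the distance from `p` determines the point, and on the preconnected `A` it takes
every intermediate value. -/
theorem eq_segment_of_isPreconnected {p q : Plane} {A : Set Plane} (hA : IsPreconnected A)
    (hp : p ∈ A) (hq : q ∈ A) (hsub : A ⊆ segment ℝ p q) : A = segment ℝ p q := by
  refine hsub.antisymm fun x hx => ?_
  by_cases hpq : p = q
  · subst hpq
    rw [segment_same] at hx
    exact hx ▸ hp
  have hD : 0 < dist p q := dist_pos.mpr hpq
  have hcont : Continuous fun y : Plane => dist p y := by fun_prop
  have hor := (hA.image _ hcont.continuousOn).ordConnected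
  have hdx := dist_add_dist_of_mem_segment hx
  have hmem : dist p x ∈ Set.Icc (dist p p) (dist p q) := by
    rw [dist_self]
    exact ⟨dist_nonneg, by linarith [dist_nonneg (x := x) (y := q)]⟩
  obtain ⟨y, hy, hyx⟩ := hor.out ⟨p, hp, rfl⟩ ⟨q, hq, rfl⟩ hmem
  have hys := hsub hy
  rw [segment_eq_image_lineMap] at hys hx
  obtain ⟨s, hs, rfl⟩ := hys
  obtain ⟨t, ht, rfl⟩ := hx
  simp only [dist_left_lineMap] at hyx
  rw [Real.norm_of_nonneg hs.1, Real.norm_of_nonneg ht.1] at hyx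
  rwa [← mul_right_cancel₀ hD.ne' hyx]

theorem isPreconnected_segment (p q : Plane) : IsPreconnected (segment ℝ p q) :=
  (convex_segment p q).isPreconnected

theorem segment_union_segment {p c q : Plane} (hc : c ∈ segment ℝ p q) :
    segment ℝ p c ∪ segment ℝ c q = segment ℝ p q := by
  refine eq_segment_of_isPreconnected ((isPreconnected_segment p c).union c
    (right_mem_segment ℝ p c) (left_mem_segment ℝ c q) (isPreconnected_segment c q))
    (Or.inl (left_mem_segment ℝ p c)) (Or.inr (right_mem_segment ℝ c q))
    (Set.union_subset ?_ ?_)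
  · exact (convex_segment p q).segment_subset (left_mem_segment ℝ p q) hc
  · exact (convex_segment p q).segment_subset hc (right_mem_segment ℝ p q)

/-! ### Piecewise linear compressions of the line and of the plane -/

theorem min_inverse_max {A B A' B' : ℝ → ℝ} (hA : ∀ y, A' (A y) = y) (hB : ∀ y, B' (B y) = y)
    (hA' : Monotone A') (hB' : Monotone B') (y : ℝ) :
    min (A' (max (A y) (B y))) (B' (max (A y) (B y))) = y := by
  rcases le_total (A y) (B y) with h | h
  · rw [max_eq_right h, hB]
    exact min_eq_right ((hA y).symm.trans_le (hA' h))
  · rw [max_eq_left h, hA]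
    exact min_eq_left ((hB y).symm.trans_le (hB' h))

theorem max_inverse_min {A B A' B' : ℝ → ℝ} (hA : ∀ y, A' (A y) = y) (hB : ∀ y, B' (B y) = y)
    (hA' : Monotone A') (hB' : Monotone B') (y : ℝ) :
    max (A' (min (A y) (B y))) (B' (min (A y) (B y))) = y := by
  rcases le_total (A y) (B y) with h | h
  · rw [min_eq_left h, hA]
    exact max_eq_left ((hB' h).trans_eq (hB y))
  · rw [min_eq_right h, hB]
    exact max_eq_right ((hA' h).trans_eq (hA y))

/-- A piecewise linear bijection of the line that is the identity outside the interval from `-a`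
to `l * N / (l - 1) * a` and maps the interval from `-a` to `N * a` affinely to the one from `-a`
to `0`. -/
noncomputable def kink (N l a y : ℝ) : ℝ := min y (max ((y - N * a) / (N + 1)) (l * (y - N * a)))

/-- The inverse of `kink`. -/
noncomputable def unkink (N l a y : ℝ) : ℝ := max y (min ((N + 1) * y + N * a) (y / l + N * a))

section kink

variable {N l : ℝ}

/-- A nested minimum and maximum of increasing bijections is inverted by exchanging minimum with
maximum and inverting each function. -/
theorem unkink_kink (hN : 0 < N) (hl : 1 < l) (a y : ℝ) : unkink N l a (kink N l a y) = y := by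
  have hN1 : 0 < N + 1 := by linarith
  have hl0 : 0 < l := by linarith
  refine max_inverse_min (A := id) (A' := id)
    (B := fun y => max ((y - N * a) / (N + 1)) (l * (y - N * a)))
    (B' := fun y => min ((N + 1) * y + N * a) (y / l + N * a)) (fun _ => rfl) ?_ monotone_id ?_ y
  · refine min_inverse_max (A' := fun y => (N + 1) * y + N * a) (B' := fun y => y / l + N * a)
      (fun y => ?_) (fun y => ?_) (fun y z h => ?_) fun y z h => ?_
    · field_simp; ring
    · field_simp; ring
    · dsimp only; gcongr
    · dsimp only; gcongr
  · intro y z h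
    dsimp only
    gcongr

theorem kink_unkink (hN : 0 < N) (hl : 1 < l) (a y : ℝ) : kink N l a (unkink N l a y) = y := by
  have hN1 : 0 < N + 1 := by linarith
  have hl0 : 0 < l := by linarith
  refine min_inverse_max (A := id) (A' := id)
    (B' := fun y => max ((y - N * a) / (N + 1)) (l * (y - N * a)))
    (B := fun y => min ((N + 1) * y + N * a) (y / l + N * a)) (fun _ => rfl) ?_ monotone_id ?_ y
  · refine max_inverse_min (A := fun y => (N + 1) * y + N * a) (B := fun y => y / l + N * a)
      (A' := fun y => (y - N * a) / (N + 1)) (B' := fun y => l * (y - N * a))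
      (fun y => ?_) (fun y => ?_) (fun y z h => ?_) fun y z h => ?_
    · field_simp; ring
    · field_simp; ring
    · dsimp only; gcongr
    · dsimp only; gcongr
  · intro y z h
    dsimp only
    gcongr

theorem kink_of_le (hN : 0 < N) {a y : ℝ} (hy : y ≤ -a) : kink N l a y = y := by
  refine min_eq_left (le_max_of_le_left ?_)
  rw [le_div_iff₀ (by linarith)]
  nlinarith

theorem kink_of_ge (hl : 1 < l) {a y : ℝ} (hy : l * N / (l - 1) * a ≤ y) :
    kink N l a y = y := by
  refine min_eq_left (le_max_of_le_right ?_)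
  have h : 0 < l - 1 := by linarith
  rw [div_mul_eq_mul_div, div_le_iff₀ h] at hy
  nlinarith

theorem kink_zero (hN : 0 < N) (hl : 1 < l) (y : ℝ) : kink N l 0 y = y := by
  rcases le_total y 0 with h | h
  · exact kink_of_le hN (by simpa using h)
  · exact kink_of_ge hl (by simpa using h)

theorem kink_of_mem (hN : 0 < N) (hl : 1 < l) {a y : ℝ} (h1 : -a ≤ y) (h2 : y ≤ N * a) :
    kink N l a y = (y - N * a) / (N + 1) := by
  have hN1 : 0 < N + 1 := by linarith
  have h3 : l * (y - N * a) ≤ (y - N * a) / (N + 1) := by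
    rw [le_div_iff₀ hN1]
    nlinarith [mul_nonneg (by linarith : 0 ≤ N * a - y) (by nlinarith : 0 ≤ l * (N + 1) - 1)]
  rw [kink, max_eq_left h3]
  refine min_eq_right ?_
  rw [div_le_iff₀ hN1]
  nlinarith

/-- The plane homeomorphism that acts by `kink` on each vertical line meeting a diamond. -/
noncomputable def kinkHomeo (hN : 0 < N) (hl : 1 < l) : ℝ × ℝ ≃ₜ ℝ × ℝ where
  toFun z := (z.1, kink N l (max 0 (1 - |z.1|)) z.2)
  invFun z := (z.1, unkink N l (max 0 (1 - |z.1|)) z.2)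
  left_inv z := by simp [unkink_kink hN hl]
  right_inv z := by simp [kink_unkink hN hl]
  continuous_toFun := by unfold kink; fun_prop
  continuous_invFun := by unfold unkink; fun_prop

end kink

/-- The determinant of two plane vectors. -/
def planeDet (a b : Plane) : ℝ := a 0 * b 1 - a 1 * b 0

theorem exists_smul_of_planeDet_eq_zero {a b : Plane} (ha : a ≠ 0) (h : planeDet a b = 0) :
    ∃ k : ℝ, b = k • a := by
  unfold planeDet at h
  by_cases h0 : a 0 = 0
  · have h1 : a 1 ≠ 0 := by
      intro h1
      apply ha
      ext i
      fin_cases i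
      · exact h0
      · exact h1
    refine ⟨b 1 / a 1, ?_⟩
    have hb : b 0 = 0 := by
      have : a 1 * b 0 = 0 := by rw [h0] at h; linarith
      exact (mul_eq_zero.mp this).resolve_left h1
    ext i
    fin_cases i
    · simp [h0, hb]
    · simp [h1]
  · refine ⟨b 0 / a 0, ?_⟩
    ext i
    fin_cases i
    · simp [h0]
    · simp only [Fin.mk_one, PiLp.smul_apply, smul_eq_mul]
      field_simp
      linarith

/-- The affine coordinate system with origin `o` and basis `u`, `w`. -/
noncomputable def planeFrame (o : Plane) {u w : Plane} (h : planeDet u w ≠ 0) :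
    ℝ × ℝ ≃ₜ Plane where
  toFun z := o + z.1 • u + z.2 • w
  invFun z := (planeDet (z - o) w / planeDet u w, planeDet u (z - o) / planeDet u w)
  left_inv z := by
    unfold planeDet at *
    ext
    · simp only [PiLp.sub_apply, PiLp.add_apply, PiLp.smul_apply, smul_eq_mul]
      rw [div_eq_iff h]
      ring
    · simp only [PiLp.sub_apply, PiLp.add_apply, PiLp.smul_apply, smul_eq_mul]
      rw [div_eq_iff h]
      ring
  right_inv z := by
    unfold planeDet at *
    ext i
    have key : ∀ a b : ℝ, a + b = (z i - o i) * (u 0 * w 1 - u 1 * w 0) →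
        o i + a / (u 0 * w 1 - u 1 * w 0) + b / (u 0 * w 1 - u 1 * w 0) = z i := by
      intro a b hab
      rw [add_assoc, ← add_div, hab, mul_div_cancel_right₀ _ h]
      ring
    simp only [PiLp.sub_apply, PiLp.add_apply, PiLp.smul_apply, smul_eq_mul,
      div_mul_eq_mul_div]
    refine key _ _ ?_
    fin_cases i
    · simp only [Fin.zero_eta]
      ring
    · simp only [Fin.mk_one]
      ring
  continuous_toFun := by fun_prop
  continuous_invFun := by unfold planeDet; fun_prop

/-- `kinkHomeo` in an affine coordinate system. -/
noncomputable def frameKink {N l : ℝ} (hN : 0 < N) (hl : 1 < l) (o : Plane) {u w : Plane}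
    (h : planeDet u w ≠ 0) : Plane ≃ₜ Plane :=
  ((planeFrame o h).symm.trans (kinkHomeo hN hl)).trans (planeFrame o h)

theorem frameKink_apply {N l : ℝ} (hN : 0 < N) (hl : 1 < l) (o : Plane) {u w : Plane}
    (h : planeDet u w ≠ 0) (x y : ℝ) : frameKink hN hl o h (o + x • u + y • w) =
      o + x • u + kink N l (max 0 (1 - |x|)) y • w := by
  have : o + x • u + y • w = planeFrame o h (x, y) := rfl
  rw [this, frameKink]
  simp only [Homeomorph.trans_apply, Homeomorph.symm_apply_apply]
  rfl

/-- Bounds the support, which lets a suitable frame confine the homeomorphism to a given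
neighbourhood. -/
theorem exists_of_frameKink_ne {N l : ℝ} (hN : 0 < N) (hl : 1 < l) (o : Plane) {u w : Plane}
    (h : planeDet u w ≠ 0) {z : Plane} (hz : frameKink hN hl o h z ≠ z) :
    ∃ x y : ℝ, |x| < 1 ∧ -1 < y ∧ y < l * N / (l - 1) ∧ z = o + x • u + y • w := by
  obtain ⟨⟨x, y⟩, rfl⟩ := (planeFrame o h).surjective z
  change frameKink hN hl o h (o + x • u + y • w) ≠ o + x • u + y • w at hz
  rw [frameKink_apply] at hz
  have hk : kink N l (max 0 (1 - |x|)) y ≠ y := fun hk => hz (by rw [hk])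
  have hx : |x| < 1 := by
    by_contra hx
    rw [max_eq_left (by linarith)] at hk
    exact hk (kink_zero hN hl y)
  rw [max_eq_right (by linarith)] at hk
  have habs := abs_nonneg x
  have hM : 0 < l * N / (l - 1) := div_pos (by nlinarith) (by linarith)
  refine ⟨x, y, hx, ?_, ?_, rfl⟩
  · by_contra hy
    exact hk (kink_of_le hN (by linarith))
  · by_contra hy
    refine hk (kink_of_ge hl ?_)
    nlinarith [mul_nonneg hM.le habs]

/-- The segment from `c` to `q` can be shortened by a homeomorphism supported near it. -/
theorem exists_pull_segment {c q : Plane} (hcq : c ≠ q) {W : Set Plane} (hW : IsOpen W)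
    (hsub : segment ℝ c q \ {c} ⊆ W) {ε : ℝ} (hε : 0 < ε) :
    ∃ h : Plane ≃ₜ Plane, (∀ z ∉ W, h z = z) ∧
      ∃ t ∈ segment ℝ c q, t ≠ c ∧ dist c t < ε ∧ h '' segment ℝ c q = segment ℝ c t := by
  set d := q - c with hd
  have hd0 : d ≠ 0 := sub_ne_zero.mpr hcq.symm
  have hdn : 0 < ‖d‖ := norm_pos_iff.mpr hd0
  have hmem : ∀ s : ℝ, 0 ≤ s → s ≤ 1 → c + s • d ∈ segment ℝ c q := fun s h0 h1 => by
    rw [segment_eq_image']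
    exact ⟨s, ⟨h0, h1⟩, rfl⟩
  have hWmem : ∀ s : ℝ, 0 < s → s ≤ 1 → c + s • d ∈ W := fun s h0 h1 => by
    refine hsub ⟨hmem s h0.le h1, ?_⟩
    simp [h0.ne', hd0]
  obtain ⟨r, hr, hrW⟩ := Metric.isOpen_iff.mp hW q (hsub ⟨right_mem_segment ℝ c q, hcq.symm⟩)
  -- The initial fraction `δ` of the segment stays fixed and the rest is compressed by the factor `N
  -- + 1`; each contributes less than `ε / 2`. The overshoot `η` beyond `q` is the room in which the
  -- compression is compensated.
  obtain ⟨δ, hδ0, hδ1, hδε⟩ : ∃ δ : ℝ, 0 < δ ∧ δ < 1 ∧ δ * ‖d‖ < ε / 2 := by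
    refine ⟨min (1 / 2) (ε / (4 * ‖d‖)), by positivity, ?_, ?_⟩
    · exact (min_le_left _ _).trans_lt (by norm_num)
    · refine (mul_le_mul_of_nonneg_right (min_le_right _ _) hdn.le).trans_lt ?_
      field_simp
      norm_num
  obtain ⟨η, hη0, hηr⟩ : ∃ η : ℝ, 0 < η ∧ η * ‖d‖ < r :=
    ⟨r / (2 * ‖d‖), by positivity, by field_simp; norm_num⟩
  have hK : IsCompact ((fun s : ℝ => c + s • d) '' Set.Icc δ (1 + η)) :=
    isCompact_Icc.image (by fun_prop)
  have hKW : (fun s : ℝ => c + s • d) '' Set.Icc δ (1 + η) ⊆ W := by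
    rintro _ ⟨s, hs, rfl⟩
    rcases le_total s 1 with h | h
    · exact hWmem s (hδ0.trans_le hs.1) h
    · apply hrW
      have : c + s • d - q = (s - 1) • d := by rw [hd]; module
      rw [Metric.mem_ball, dist_eq_norm, this, norm_smul, Real.norm_of_nonneg (by linarith)]
      exact (mul_le_mul_of_nonneg_right (by linarith [hs.2]) hdn.le).trans_lt hηr
  obtain ⟨ρ, hρ, hρW⟩ := hK.exists_thickening_subset_open hW hKW
  obtain ⟨N, hN0, hNε⟩ : ∃ N : ℝ, 0 < N ∧ ‖d‖ / (N + 1) < ε / 2 := by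
    refine ⟨4 * ‖d‖ / ε, by positivity, ?_⟩
    rw [div_lt_iff₀ (by positivity)]
    field_simp
    linarith
  have hN1 : 0 < N + 1 := by linarith
  -- This slope makes the support end at height `N * (1 + η)`, hence before `c + (1 + η) • d`.
  set l : ℝ := 1 + 1 / η with hl
  have hl1 : 1 < l := by rw [hl]; linarith [one_div_pos.mpr hη0]
  have hlN : l * N / (l - 1) = N * (1 + η) := by
    rw [hl]; field_simp; ring
  -- On the axis of the frame, height `-1` is `c + δ • d`, height `N` is `q`, and height `0` is the
  -- image of `q`. The transverse vector `u` is shorter than `ρ`, so the support stays in the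
  -- `ρ`-thickening.
  set w : Plane := ((1 - δ) / (N + 1)) • d with hw
  set u : Plane := (ρ / (2 * ‖d‖)) • !₂[-d 1, d 0] with hu
  have hnd : ‖(!₂[-d 1, d 0] : Plane)‖ = ‖d‖ := by
    rw [EuclideanSpace.norm_eq, EuclideanSpace.norm_eq]
    simp [Fin.sum_univ_two, add_comm]
  have hun : ‖u‖ < ρ := by
    rw [hu, norm_smul, hnd, Real.norm_of_nonneg (by positivity)]
    field_simp
    norm_num
  have hdet : planeDet u w ≠ 0 := by
    have h2 : d 0 ^ 2 + d 1 ^ 2 ≠ 0 := by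
      intro h0
      apply hd0
      ext i
      fin_cases i
      · simp; nlinarith [sq_nonneg (d 0), sq_nonneg (d 1)]
      · simp; nlinarith [sq_nonneg (d 0), sq_nonneg (d 1)]
    have h3 : planeDet u w =
        -(ρ / (2 * ‖d‖) * ((1 - δ) / (N + 1)) * (d 0 ^ 2 + d 1 ^ 2)) := by
      simp [planeDet, hu, hw]
      ring
    rw [h3, neg_ne_zero]
    have h4 : (1 - δ) / (N + 1) ≠ 0 := (div_pos (by linarith) hN1).ne'
    exact mul_ne_zero (mul_ne_zero (by positivity) h4) h2
  set o : Plane := c + δ • d + w with ho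
  have hline : ∀ y : ℝ, o + y • w = c + (δ + (1 - δ) * (1 + y) / (N + 1)) • d := by
    intro y
    rw [ho, hw]
    module
  have hfix : ∀ z ∉ W, frameKink hN0 hl1 o hdet z = z := by
    intro z hz
    by_contra hne
    obtain ⟨x, y, hx, hy, hy', rfl⟩ := exists_of_frameKink_ne hN0 hl1 o hdet hne
    refine hz (hρW (Metric.mem_thickening_iff.mpr ⟨o + y • w, ?_, ?_⟩))
    · rw [hline]
      refine ⟨_, ⟨?_, ?_⟩, rfl⟩
      · have : 0 ≤ (1 - δ) * (1 + y) / (N + 1) :=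
          div_nonneg (mul_nonneg (by linarith) (by linarith)) hN1.le
        linarith
      · have : (1 - δ) * (1 + y) / (N + 1) ≤ (1 - δ) * (1 + η) := by
          rw [div_le_iff₀ hN1, mul_assoc]
          refine mul_le_mul_of_nonneg_left ?_ (by linarith)
          rw [hlN] at hy'
          nlinarith
        nlinarith [mul_pos hδ0 hη0]
    · have : o + x • u + y • w - (o + y • w) = x • u := by module
      rw [dist_eq_norm, this, norm_smul, Real.norm_eq_abs]
      nlinarith [norm_nonneg u]
  have hτ : ∀ s : ℝ, c + s • d = o + (0 : ℝ) • u + ((s - δ) * (N + 1) / (1 - δ) - 1) • w := by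
    intro s
    have h1δ : 1 - δ ≠ 0 := by linarith
    rw [zero_smul, add_zero, hline]
    congr 2
    field_simp
    ring
  have hval : ∀ s : ℝ, 0 ≤ s → s ≤ 1 → ∃ s' : ℝ, 0 ≤ s' ∧ s' ≤ δ + (1 - δ) / (N + 1) ∧
      frameKink hN0 hl1 o hdet (c + s • d) = c + s' • d := by
    intro s hs0 hs1
    have h1δ : 0 < 1 - δ := by linarith
    rcases le_total s δ with h | h
    · refine ⟨s, hs0, h.trans (by linarith [div_pos h1δ hN1]), ?_⟩
      rw [hτ, frameKink_apply, kink_of_le hN0]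
      simp only [abs_zero, sub_zero, zero_le_one, max_eq_right]
      have : (s - δ) * (N + 1) / (1 - δ) ≤ 0 :=
        div_nonpos_of_nonpos_of_nonneg (mul_nonpos_of_nonpos_of_nonneg (by linarith) hN1.le) h1δ.le
      linarith
    · refine ⟨δ + (s - δ) / (N + 1), ?_, ?_, ?_⟩
      · have : 0 ≤ (s - δ) / (N + 1) := div_nonneg (by linarith) hN1.le
        linarith
      · gcongr
      · rw [hτ s, frameKink_apply, kink_of_mem hN0 hl1, zero_smul, add_zero, hline]
        · congr 2
          simp only [abs_zero, sub_zero, zero_le_one, max_eq_right]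
          field_simp
          ring
        · simp only [abs_zero, sub_zero, zero_le_one, max_eq_right]
          have : 0 ≤ (s - δ) * (N + 1) / (1 - δ) :=
            div_nonneg (mul_nonneg (by linarith) hN1.le) h1δ.le
          linarith
        · simp only [abs_zero, sub_zero, zero_le_one, max_eq_right]
          have : (s - δ) * (N + 1) / (1 - δ) ≤ N + 1 := by
            rw [div_le_iff₀ h1δ]
            nlinarith
          linarith
  set T : ℝ := δ + (1 - δ) / (N + 1) with hT
  have hT0 : 0 < T := by
    have : 0 < (1 - δ) / (N + 1) := div_pos (by linarith) hN1
    linarith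
  have hT1 : T ≤ 1 := by
    have : (1 - δ) / (N + 1) ≤ 1 - δ := div_le_self (by linarith) (by linarith)
    linarith
  have hq : q = c + (1 : ℝ) • d := by rw [hd]; module
  have hkc : frameKink hN0 hl1 o hdet c = c := by
    have h0 : c = c + (0 : ℝ) • d := by module
    conv_lhs => rw [h0, hτ, frameKink_apply]
    rw [kink_of_le hN0, ← hτ, zero_smul, add_zero]
    simp only [abs_zero, sub_zero, zero_le_one, max_eq_right]
    have : (0 - δ) * (N + 1) / (1 - δ) ≤ 0 :=
      div_nonpos_of_nonpos_of_nonneg (mul_nonpos_of_nonpos_of_nonneg (by linarith) hN1.le)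
        (by linarith)
    linarith
  have hkq : frameKink hN0 hl1 o hdet q = c + T • d := by
    have h1δ : 1 - δ ≠ 0 := by linarith
    have h1 : (1 - δ) * (N + 1) / (1 - δ) - 1 = N := by field_simp; ring
    rw [hq, hτ, frameKink_apply, kink_of_mem hN0 hl1, h1, zero_smul, add_zero, hline]
    · simp [hT]
    · rw [h1]; simp; linarith
    · rw [h1]; simp
  refine ⟨frameKink hN0 hl1 o hdet, hfix, c + T • d, hmem T hT0.le hT1, ?_, ?_, ?_⟩
  · simp [hT0.ne', hd0]
  · rw [dist_self_add_right, norm_smul, Real.norm_of_nonneg hT0.le, hT, add_mul]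
    have : (1 - δ) / (N + 1) * ‖d‖ ≤ ‖d‖ / (N + 1) := by
      rw [div_mul_eq_mul_div]
      gcongr
      nlinarith
    linarith
  · refine eq_segment_of_isPreconnected
      ((isPreconnected_segment c q).image _ (Homeomorph.continuous _).continuousOn)
      ⟨c, left_mem_segment ℝ c q, hkc⟩ ⟨q, right_mem_segment ℝ c q, hkq⟩ ?_
    rintro _ ⟨z, hz, rfl⟩
    rw [segment_eq_image'] at hz
    obtain ⟨s, hs, rfl⟩ := hz
    obtain ⟨s', h0, h1, h2⟩ := hval s hs.1 hs.2
    have h3 : frameKink hN0 hl1 o hdet (c + s • (q - c)) = c + s' • d := h2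
    rw [h3, segment_eq_image']
    refine ⟨s' / T, ⟨by positivity, (div_le_one hT0).mpr h1⟩, ?_⟩
    simp only [add_sub_cancel_left, smul_smul]
    rw [div_mul_cancel₀ _ hT0.ne']

/-- A bend can be straightened by a homeomorphism supported near it that fixes one side. -/
theorem exists_straighten {c u t : Plane} (h : planeDet u (t - c) ≠ 0) {R : ℝ}
    (hR : 4 * ‖u‖ + 2 * dist c t < R) :
    ∃ g : Plane ≃ₜ Plane, (∀ z ∉ Metric.ball c R, g z = z) ∧
      (∀ s : ℝ, 0 ≤ s → g (c - s • u) = c - s • u) ∧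
      g '' segment ℝ c t = segment ℝ c (c + u) := by
  -- In the frame with origin `c + u` and basis `u`, `w`, the segment from `c` to `t` is the edge `y
  -- = 1 - |x|`, `x ≤ 0`, of the diamond. With `N = 1` the kink lowers it to `y = 0`, while the ray
  -- opposite to `u` lies in `x ≤ -1` and is fixed.
  set w := t - c - u with hw
  have hdet : planeDet u w ≠ 0 := by
    have : planeDet u w = planeDet u (t - c) := by
      simp only [planeDet, hw, PiLp.sub_apply]
      ring
    rwa [this]
  have hval : ∀ s : ℝ, 0 ≤ s → s ≤ 1 →
      frameKink one_pos one_lt_two (c + u) hdet (c + s • (t - c)) = c + s • u := by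
    intro s h0 h1
    have e1 : c + s • (t - c) = c + u + (s - 1) • u + s • w := by rw [hw]; module
    have e2 : max 0 (1 - |s - 1|) = s := by
      rw [abs_of_nonpos (by linarith), max_eq_right] <;> linarith
    rw [e1, frameKink_apply, e2, kink_of_mem one_pos one_lt_two (by linarith) (by linarith)]
    rw [one_mul, sub_self, zero_div]
    module
  refine ⟨frameKink one_pos one_lt_two (c + u) hdet, ?_, ?_, ?_⟩
  · intro z hz
    by_contra hne
    obtain ⟨x, y, hx, hy, hy', rfl⟩ := exists_of_frameKink_ne _ _ _ hdet hne
    apply hz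
    have e1 : c + u + x • u + y • w - c = (1 + x - y) • u + y • (t - c) := by rw [hw]; module
    rw [Metric.mem_ball, dist_eq_norm, e1]
    refine ((norm_add_le _ _).trans ?_).trans_lt hR
    rw [norm_smul, norm_smul, ← dist_eq_norm t c, dist_comm t c, Real.norm_eq_abs,
      Real.norm_eq_abs]
    have hx' := abs_lt.mp hx
    norm_num at hy'
    have h1 : |1 + x - y| ≤ 4 := abs_le.mpr ⟨by linarith, by linarith⟩
    have h2 : |y| ≤ 2 := abs_le.mpr ⟨by linarith, by linarith⟩
    gcongr
  · intro s hs
    have e1 : c - s • u = c + u + (-1 - s) • u + (0 : ℝ) • w := by module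
    have e2 : max 0 (1 - |-1 - s|) = 0 := by
      rw [abs_of_nonpos (by linarith), max_eq_left]
      linarith
    rw [e1, frameKink_apply, e2, kink_zero one_pos one_lt_two]
  · rw [segment_eq_image', segment_eq_image', Set.image_image]
    refine Set.image_congr fun s hs => ?_
    rw [hval s hs.1 hs.2, add_sub_cancel_left]

/-- A polygonal arc can be contracted to a short segment by a homeomorphism supported near it. -/
theorem PolygonalArc.exists_contraction {p q : Plane} {C : Set Plane} (hC : PolygonalArc p q C) :
    ∀ {W : Set Plane}, IsOpen W → C \ {p} ⊆ W → ∀ {ε : ℝ}, 0 < ε →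
    ∃ h : Plane ≃ₜ Plane, (∀ z ∉ W, h z = z) ∧
      ∃ t, t ≠ p ∧ dist p t < ε ∧ segment ℝ p t \ {p} ⊆ W ∧ h '' C = segment ℝ p t := by
  -- It suffices to reach some segment at `p` inside `W`; a final pull makes it shorter than `ε`.
  have hfin : ∀ {p t : Plane} {C W : Set Plane} {ε : ℝ} (h : Plane ≃ₜ Plane), IsOpen W →
      0 < ε → (∀ z ∉ W, h z = z) → t ≠ p → segment ℝ p t \ {p} ⊆ W → h '' C = segment ℝ p t →
      ∃ h : Plane ≃ₜ Plane, (∀ z ∉ W, h z = z) ∧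
        ∃ t, t ≠ p ∧ dist p t < ε ∧ segment ℝ p t \ {p} ⊆ W ∧ h '' C = segment ℝ p t := by
    intro p t C W ε h hW hε hfix htp hsub him
    obtain ⟨g, hg, t', ht's, ht'p, ht'ε, hg'⟩ := exists_pull_segment htp.symm hW hsub hε
    refine ⟨h.trans g, fun z hz => ?_, t', ht'p, ht'ε, ?_, ?_⟩
    · rw [Homeomorph.trans_apply, hfix z hz, hg z hz]
    · exact (Set.sdiff_subset_sdiff_left ((convex_segment p t).segment_subset
        (left_mem_segment ℝ p t) ht's)).trans hsub
    · rw [← hg', ← him, Set.image_image]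
      rfl
  induction hC with
  | @single p q h =>
    intro W hW hsub ε hε
    exact hfin (Homeomorph.refl _) hW hε (fun _ _ => rfl) h.symm hsub (Set.image_id _)
  | @cons p c q C hpc hC hd ih =>
    intro W hW hsub ε hε
    have hclosed : IsClosed (segment ℝ p c) := (isArc_segment hpc).isCompact.isClosed
    have hcW : c ∈ W := hsub ⟨Or.inl (right_mem_segment ℝ p c), hpc.symm⟩
    obtain ⟨R, hR, hRW⟩ := Metric.isOpen_iff.mp hW c hcW
    -- The tail is contracted away from the first segment, which therefore stays fixed.
    have hCW : C \ {c} ⊆ W \ segment ℝ p c := by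
      rintro x ⟨hx, hxc⟩
      refine ⟨hsub ⟨Or.inr hx, ?_⟩, fun h => hxc (hd ⟨h, hx⟩)⟩
      rintro rfl
      exact hxc (hd ⟨left_mem_segment ℝ x c, hx⟩)
    obtain ⟨h, hfix, t, htc, htR, hts, him⟩ :=
      ih (hW.sdiff hclosed) hCW (ε := R / 4) (by linarith)
    have hfix' : ∀ z ∉ W, h z = z := fun z hz => hfix z fun h' => hz h'.1
    have hpcW : segment ℝ p c \ {p} ⊆ W := fun x hx => hsub ⟨Or.inl hx.1, hx.2⟩
    have himpc : h '' segment ℝ p c = segment ℝ p c := by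
      rw [Set.image_congr (g := id) fun x hx => hfix x fun h' => h'.2 hx, Set.image_id]
    by_cases hdet : planeDet (c - p) (t - c) = 0
    · obtain ⟨k, hk⟩ := exists_smul_of_planeDet_eq_zero (sub_ne_zero.mpr hpc.symm) hdet
      have ht : t = c + k • (c - p) := by rw [← hk]; module
      -- For negative `k` the contracted tail would run back into the segment from `p` to `c`, which
      -- it avoids. The parameter `s` below picks a point close enough to `c` to lie on both.
      have hk0 : 0 < k := by
        by_contra hk0
        push Not at hk0
        have hne : k ≠ 0 := by
          rintro rfl
          exact htc (by simpa using ht)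
        have hkneg : k < 0 := lt_of_le_of_ne hk0 hne
        set s : ℝ := 1 / (1 - k) with hs
        have hs1 : s * (1 - k) = 1 := by rw [hs]; exact one_div_mul_cancel (by linarith)
        have hs0 : 0 < s := by rw [hs]; apply one_div_pos.mpr; linarith
        have hsk : -1 ≤ s * k := by nlinarith
        have hx : c + s • (t - c) ∈ segment ℝ c t := by
          rw [segment_eq_image']
          exact ⟨s, ⟨hs0.le, by nlinarith⟩, rfl⟩
        have hxc : c + s • (t - c) ≠ c := by simp [hs0.ne', sub_ne_zero.mpr htc]
        refine (hts ⟨hx, hxc⟩).2 ?_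
        rw [segment_symm, segment_eq_image']
        refine ⟨-(s * k), ⟨by nlinarith, by linarith⟩, ?_⟩
        rw [hk]
        module
      have hcs : c ∈ segment ℝ p t := by
        rw [segment_eq_image']
        refine ⟨1 / (1 + k), ⟨by positivity, by rw [div_le_one] <;> linarith⟩, ?_⟩
        have : t - p = (1 + k) • (c - p) := by rw [ht]; module
        simp only [this, smul_smul]
        rw [one_div_mul_cancel (by linarith)]
        module
      refine hfin (t := t) h hW hε hfix' ?_ ?_ ?_
      · rintro rfl
        have : (1 + k) • (c - t) = 0 := by
          have := sub_eq_zero.mpr ht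
          rw [← neg_zero, ← this]
          module
        rcases smul_eq_zero.mp this with h | h
        · linarith
        · exact hpc.symm (sub_eq_zero.mp h)
      · rw [← segment_union_segment hcs]
        rintro x ⟨hx | hx, hxp⟩
        · exact hpcW ⟨hx, hxp⟩
        · by_cases hxc : x = c
          · exact hxc ▸ hcW
          · exact (hts ⟨hx, hxc⟩).1
      · rw [Set.image_union, him, himpc, segment_union_segment hcs]
    · set n := ‖c - p‖ with hn
      have hn0 : 0 < n := norm_pos_iff.mpr (sub_ne_zero.mpr hpc.symm)
      -- The new direction vector has length `R / 16`. With the tail shorter than `R / 4`, the bound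
      -- `4 * ‖u‖ + 2 * dist c t < R` holds.
      set κ : ℝ := R / (16 * n) with hκ
      have hκ0 : 0 < κ := by positivity
      have hdet' : planeDet (κ • (c - p)) (t - c) ≠ 0 := by
        have : planeDet (κ • (c - p)) (t - c) = κ * planeDet (c - p) (t - c) := by
          simp only [planeDet, PiLp.smul_apply, smul_eq_mul]
          ring
        rw [this]
        exact mul_ne_zero hκ0.ne' hdet
      have hun : ‖κ • (c - p)‖ = R / 16 := by
        rw [norm_smul, Real.norm_of_nonneg hκ0.le, ← hn, hκ]
        field_simp
      obtain ⟨g, hg1, hg2, hg3⟩ := exists_straighten hdet' (R := R) (by rw [hun]; linarith)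
      have hcs : c ∈ segment ℝ p (c + κ • (c - p)) := by
        rw [segment_eq_image']
        refine ⟨1 / (1 + κ), ⟨by positivity, by rw [div_le_one] <;> linarith⟩, ?_⟩
        have : c + κ • (c - p) - p = (1 + κ) • (c - p) := by module
        simp only [this, smul_smul]
        rw [one_div_mul_cancel (by linarith)]
        module
      have hgpc : g '' segment ℝ p c = segment ℝ p c := by
        rw [Set.image_congr (g := id), Set.image_id]
        intro x hx
        rw [segment_symm, segment_eq_image'] at hx
        obtain ⟨s, hs, rfl⟩ := hx
        have := hg2 (s / κ) (div_nonneg hs.1 hκ0.le)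
        rw [smul_smul, div_mul_cancel₀ _ hκ0.ne'] at this
        have e : c + s • (p - c) = c - s • (c - p) := by module
        simp only [id, e, this]
      refine hfin (t := c + κ • (c - p)) (h.trans g) hW hε ?_ ?_ ?_ ?_
      · intro z hz
        rw [Homeomorph.trans_apply, hfix' z hz, hg1 z fun h' => hz (hRW h')]
      · intro heq
        have : (1 + κ) • (c - p) = 0 := by
          have := sub_eq_zero.mpr heq
          rw [← this]
          module
        rcases smul_eq_zero.mp this with h | h
        · linarith
        · exact hpc.symm (sub_eq_zero.mp h)
      · rw [← segment_union_segment hcs]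
        rintro x ⟨hx | hx, hxp⟩
        · exact hpcW ⟨hx, hxp⟩
        · refine hRW ((convex_ball c R).segment_subset (Metric.mem_ball_self hR) ?_ hx)
          rw [Metric.mem_ball, dist_self_add_left, hun]
          linarith
      · have : (h.trans g) '' (segment ℝ p c ∪ C) = g '' (h '' (segment ℝ p c ∪ C)) := by
          rw [Set.image_image]
          rfl
        rw [this, Set.image_union, him, himpc, Set.image_union, hgpc, hg3,
          segment_union_segment hcs]

/-! ### Drawings with all vertices on the horizontal axis -/

/-- The vertical shear `(x, y) ↦ (x, y + p x)`. -/
noncomputable def verticalShear (p : ℝ → ℝ) (hp : Continuous p) : Plane ≃ₜ Plane where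
  toFun z := !₂[z 0, z 1 + p (z 0)]
  invFun z := !₂[z 0, z 1 - p (z 0)]
  left_inv z := by ext i; fin_cases i <;> simp
  right_inv z := by ext i; fin_cases i <;> simp
  continuous_toFun := by fun_prop
  continuous_invFun := by fun_prop

/-- The horizontal shear `(x, y) ↦ (x + q y, y)`. -/
noncomputable def horizontalShear (q : ℝ → ℝ) (hq : Continuous q) : Plane ≃ₜ Plane where
  toFun z := !₂[z 0 + q (z 1), z 1]
  invFun z := !₂[z 0 - q (z 1), z 1]
  left_inv z := by ext i; fin_cases i <;> simp
  right_inv z := by ext i; fin_cases i <;> simp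
  continuous_toFun := by fun_prop
  continuous_invFun := by fun_prop

/-- The reflection `(x, y) ↦ (y, x)`. -/
noncomputable def coordinateSwap : Plane ≃ₜ Plane where
  toFun z := !₂[z 1, z 0]
  invFun z := !₂[z 1, z 0]
  left_inv z := by ext i; fin_cases i <;> simp
  right_inv z := by ext i; fin_cases i <;> simp
  continuous_toFun := by fun_prop
  continuous_invFun := by fun_prop

theorem verticalShear_apply (p : ℝ → ℝ) (hp : Continuous p) (z : Plane) :
    verticalShear p hp z = !₂[z 0, z 1 + p (z 0)] := rfl

theorem horizontalShear_apply (q : ℝ → ℝ) (hq : Continuous q) (z : Plane) :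
    horizontalShear q hq z = !₂[z 0 + q (z 1), z 1] := rfl

theorem coordinateSwap_apply (z : Plane) : coordinateSwap z = !₂[z 1, z 0] := rfl

theorem apply_one_of_mem_segment {p q z : Plane} (hp : p 1 = 0) (hq : q 1 = 0)
    (hz : z ∈ segment ℝ p q) : z 1 = 0 := by
  obtain ⟨a, b, -, -, -, rfl⟩ := hz
  simp [hp, hq]

theorem mem_segment_of_apply_zero {p q z : Plane} (hp : p 1 = 0) (hq : q 1 = 0) (hz : z 1 = 0)
    (h : z 0 ∈ Set.uIcc (p 0) (q 0)) : z ∈ segment ℝ p q := by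
  rw [← segment_eq_uIcc] at h
  obtain ⟨a, b, ha, hb, hab, h⟩ := h
  refine ⟨a, b, ha, hb, hab, ?_⟩
  ext i
  fin_cases i
  · simpa using h
  · simp [hp, hq, hz]

/-- An injective continuous real function on an interval is monotone, so the arc cannot leave the
range between its ends. To show an edge straight after a homeomorphism it thus suffices to place it
on the axis. -/
theorem IsArc.eq_segment_of_axis {p q : Plane} {A : Set Plane} (hA : IsArc p q A)
    (h : ∀ z ∈ A, z 1 = 0) : A = segment ℝ p q := by
  have hp := h p hA.left_mem
  have hq := h q hA.right_mem
  have hpA := hA.left_mem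
  have hqA := hA.right_mem
  obtain ⟨γ, hγ, rfl⟩ := hA
  refine eq_segment_of_isPreconnected (isPreconnected_range γ.continuous) hpA hqA ?_
  have hcont : Continuous fun t => γ t 0 := by
    have := γ.continuous
    fun_prop
  have hinj : Function.Injective fun t => γ t 0 := by
    intro s t hst
    apply hγ
    ext i
    fin_cases i
    · exact hst
    · exact (h _ ⟨s, rfl⟩).trans (h _ ⟨t, rfl⟩).symm
  rintro _ ⟨t, rfl⟩
  refine mem_segment_of_apply_zero hp hq (h _ ⟨t, rfl⟩) ?_
  have h0 := t.2.1
  have h1 := t.2.2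
  have e0 : p 0 = (γ 0) 0 := by rw [γ.source]
  have e1 : q 0 = (γ 1) 0 := by rw [γ.target]
  rw [e0, e1]
  rcases hcont.strictMono_of_inj_boundedOrder' hinj with hm | hm
  · exact Set.mem_uIcc.mpr (Or.inl ⟨hm.monotone h0, hm.monotone h1⟩)
  · exact Set.mem_uIcc.mpr (Or.inr ⟨hm.antitone h1, hm.antitone h0⟩)

/-- Piecewise linear interpolation. -/
theorem exists_piecewise_linear (f : ℝ → ℝ) (s : Finset ℝ) : ∃ p : ℝ → ℝ, Continuous p ∧
    (∀ x ∈ s, p x = f x) ∧ ∀ a ∈ s, ∀ b ∈ s, a < b → (∀ c ∈ s, ¬ (a < c ∧ c < b)) →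
      ∀ t : ℝ, 0 ≤ t → t ≤ 1 → p (a + t * (b - a)) = f a + t * (f b - f a) := by
  induction s using Finset.induction_on_max with
  | empty => exact ⟨fun _ => 0, continuous_const, by simp, by simp⟩
  | insert a s has ih =>
    obtain ⟨p, hp, hps, hpl⟩ := ih
    rcases s.eq_empty_or_nonempty with rfl | hne
    · refine ⟨fun _ => f a, continuous_const, by simp, ?_⟩
      intro x hx y hy hxy
      simp only [insert_empty_eq, Finset.mem_singleton] at hx hy
      exact absurd hxy (by simp [hx, hy])
    set m := s.max' hne with hm
    have hms : m ∈ s := s.max'_mem hne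
    have hma : m < a := has m hms
    have hle : ∀ x ∈ s, x ≤ m := fun x hx => s.le_max' x hx
    -- The new interpolant freezes `p` at the old maximum `m` and adds a linear ramp beyond it.
    have hlow : ∀ x ≤ m, p (min x m) + (f a - f m) / (a - m) * max 0 (x - m) = p x := by
      intro x hx
      rw [min_eq_left hx, max_eq_left (by linarith), mul_zero, add_zero]
    have hhigh : ∀ t : ℝ, 0 ≤ t → p (min (m + t * (a - m)) m) +
        (f a - f m) / (a - m) * max 0 (m + t * (a - m) - m) = f m + t * (f a - f m) := by
      intro t ht
      have hta : 0 ≤ t * (a - m) := mul_nonneg ht (by linarith)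
      rw [min_eq_right (by linarith), max_eq_right (by linarith), hps m hms]
      have : a - m ≠ 0 := by linarith
      field_simp
      ring
    refine ⟨fun x => p (min x m) + (f a - f m) / (a - m) * max 0 (x - m), by fun_prop, ?_, ?_⟩
    · intro x hx
      rcases Finset.mem_insert.mp hx with rfl | hx
      · have := hhigh 1 zero_le_one
        rw [one_mul, one_mul, add_sub_cancel, add_sub_cancel] at this
        exact this
      · exact (hlow x (hle x hx)).trans (hps x hx)
    · intro x hx y hy hxy hbet t ht0 ht1
      rcases Finset.mem_insert.mp hx with rfl | hxs
      · rcases Finset.mem_insert.mp hy with rfl | hys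
        · exact absurd hxy (lt_irrefl _)
        · exact absurd (has y hys) (not_lt.mpr hxy.le)
      rcases Finset.mem_insert.mp hy with rfl | hys
      · obtain rfl : x = m := by
          by_contra hxm
          exact hbet m (Finset.mem_insert_of_mem hms) ⟨lt_of_le_of_ne (hle x hxs) hxm, hma⟩
        exact hhigh t ht0
      · refine (hlow _ ?_).trans (hpl x hxs y hys hxy
          (fun c hc => hbet c (Finset.mem_insert_of_mem hc)) t ht0 ht1)
        have := hle y hys
        nlinarith

/-- No value of `τ` lies strictly between `τ u` and `τ v`. -/
def NoneBetween {V : Type*} (τ : V → ℝ) (u v : V) : Prop :=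
  ∀ x, ¬ (τ u < τ x ∧ τ x < τ v) ∧ ¬ (τ v < τ x ∧ τ x < τ u)

theorem exists_interpolation {V : Type*} [Finite V] {τ : V → ℝ} (hτ : Function.Injective τ)
    (σ : V → ℝ) : ∃ p : ℝ → ℝ, Continuous p ∧ (∀ v, p (τ v) = σ v) ∧
      ∀ u v, NoneBetween τ u v → ∀ t : ℝ, 0 ≤ t → t ≤ 1 →
        p (τ u + t * (τ v - τ u)) = σ u + t * (σ v - σ u) := by
  classical
  have := Fintype.ofFinite V
  obtain ⟨p, hp, hps, hpl⟩ := exists_piecewise_linear (Function.extend τ σ 0)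
    (Finset.univ.image τ)
  have hmem : ∀ v, τ v ∈ Finset.univ.image τ := fun v =>
    Finset.mem_image_of_mem _ (Finset.mem_univ v)
  have hext : ∀ v, Function.extend τ σ 0 (τ v) = σ v := fun v => hτ.extend_apply σ 0 v
  have hval : ∀ v, p (τ v) = σ v := fun v => (hps _ (hmem v)).trans (hext v)
  refine ⟨p, hp, hval, ?_⟩
  intro u v huv t ht0 ht1
  have hb : ∀ a b, NoneBetween τ a b → ∀ c ∈ Finset.univ.image τ, ¬ (τ a < c ∧ c < τ b) := by
    intro a b hab c hc
    obtain ⟨x, -, rfl⟩ := Finset.mem_image.mp hc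
    exact (hab x).1
  rcases lt_trichotomy (τ u) (τ v) with h | h | h
  · rw [hpl _ (hmem u) _ (hmem v) h (hb u v huv) t ht0 ht1, hext, hext]
  · obtain rfl := hτ h
    simp [hval]
  · have := hpl _ (hmem v) _ (hmem u) h (hb v u fun x => (huv x).symm) (1 - t) (by linarith)
      (by linarith)
    rw [hext, hext] at this
    rw [show τ u + t * (τ v - τ u) = τ v + (1 - t) * (τ u - τ v) by ring, this]
    ring

/-- Points of the axis can be permuted by a homeomorphism of the plane that keeps given intervals
on the axis. -/
theorem exists_axis_permutation {V : Type*} [Finite V] {τ σ : V → ℝ} (hτ : Function.Injective τ)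
    (hσ : Function.Injective σ) : ∃ h : Plane ≃ₜ Plane, (∀ v, h !₂[τ v, 0] = !₂[σ v, 0]) ∧
      ∀ u v, NoneBetween τ u v → NoneBetween σ u v →
        ∀ z ∈ segment ℝ !₂[τ u, 0] !₂[τ v, 0], (h z) 1 = 0 := by
  obtain ⟨p, hp, hpv, hpl⟩ := exists_interpolation hτ σ
  obtain ⟨q, hq, hqv, hql⟩ := exists_interpolation hσ fun v => -τ v
  -- A vertex travels `(τ, 0) ↦ (τ, σ) ↦ (0, σ) ↦ (σ, 0)`. Between neighbours in both orders the two
  -- interpolations are affine, so the same cancellation holds along the segment.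
  refine ⟨((verticalShear p hp).trans (horizontalShear q hq)).trans coordinateSwap, ?_, ?_⟩
  · intro v
    simp [verticalShear_apply, horizontalShear_apply, coordinateSwap_apply, hpv, hqv]
  · intro u v hu hv z hz
    rw [segment_eq_image'] at hz
    obtain ⟨t, ⟨ht0, ht1⟩, rfl⟩ := hz
    simp [verticalShear_apply, horizontalShear_apply, coordinateSwap_apply, hpl u v hu t ht0 ht1,
      hql u v hv t ht0 ht1]
    ring

/-- An end of a longest path is a leaf: another neighbour would either close a cycle or extend the
path. -/
theorem exists_leaf {V : Type*} [Finite V] {F : SimpleGraph V} (hF : F.IsAcyclic) (hne : F ≠ ⊥) :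
    ∃ u w, F.Adj u w ∧ ∀ x, F.Adj u x → x = w := by
  classical
  have := Fintype.ofFinite V
  obtain ⟨a, b, hab⟩ : ∃ a b, F.Adj a b := by
    by_contra hcon
    push Not at hcon
    exact hne (by ext a b; simpa using hcon a b)
  let S : Set ℕ := {n | ∃ u v, ∃ p : F.Walk u v, p.IsPath ∧ p.length = n}
  have hSb : BddAbove S := ⟨Fintype.card V, by
    rintro n ⟨u, v, p, hp, rfl⟩
    exact hp.length_lt.le⟩
  have h1S : 1 ∈ S := ⟨a, b, hab.toWalk, by simp [SimpleGraph.Walk.isPath_def, hab.ne], by simp⟩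
  obtain ⟨u, v, p, hp, hlen⟩ := Nat.sSup_mem ⟨1, h1S⟩ hSb
  have hlen1 : 1 ≤ p.length := hlen ▸ le_csSup hSb h1S
  have hnil : ¬ p.Nil := fun h => by
    have := SimpleGraph.Walk.length_eq_zero_iff.mpr h
    omega
  refine ⟨u, p.snd, p.adj_snd hnil, fun x hx => ?_⟩
  by_cases hxp : x ∈ p.support
  · exact hF.eq_snd_of_adj_start hp hx hxp
  · have : p.length + 1 ∈ S := ⟨x, v, .cons hx.symm p, hp.cons hxp, by simp⟩
    have := le_csSup hSb this
    omega

/-- Each index excludes at most one value of `c`. -/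
theorem exists_shear_coefficient {ι : Type*} [Finite ι] (a b : ι → ℝ)
    (hab : ∀ i, a i ≠ 0 ∨ b i ≠ 0) : ∃ c : ℝ, ∀ i, a i + c * b i ≠ 0 := by
  have hfin : (⋃ i, {c : ℝ | a i + c * b i = 0}).Finite := by
    refine Set.finite_iUnion fun i => ?_
    by_cases hb : b i = 0
    · have ha : a i ≠ 0 := (hab i).resolve_right (by simp [hb])
      simp [hb, ha]
    · refine (Set.finite_singleton (-a i / b i)).subset fun c hc => ?_
      rw [Set.mem_singleton_iff, eq_div_iff hb]
      have hc' : a i + c * b i = 0 := hc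
      linarith
  obtain ⟨c, hc⟩ := hfin.exists_notMem
  exact ⟨c, fun i hi => hc (Set.mem_iUnion.mpr ⟨i, hi⟩)⟩

theorem plane_ext {p q : Plane} (h0 : p 0 = q 0) (h1 : p 1 = q 1) : p = q := by
  ext i
  fin_cases i
  · exact h0
  · exact h1

/-- A generic horizontal shear makes the abscissas distinct; a vertical shear by an interpolating
function then cancels the ordinates. -/
theorem exists_points_to_axis {V : Type*} [Finite V] {P : V → Plane} (hP : Function.Injective P) :
    ∃ h : Plane ≃ₜ Plane, ∀ v, (h (P v)) 1 = 0 := by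
  obtain ⟨c, hc⟩ := exists_shear_coefficient (ι := {x : V × V // x.1 ≠ x.2})
    (fun x => P x.1.1 0 - P x.1.2 0) (fun x => P x.1.1 1 - P x.1.2 1) (by
      rintro ⟨⟨u, v⟩, huv⟩
      by_contra hcon
      push Not at hcon
      exact huv (hP (plane_ext (sub_eq_zero.mp hcon.1) (sub_eq_zero.mp hcon.2))))
  have hinj : Function.Injective fun v => P v 0 + c * P v 1 := by
    intro u v huv
    by_contra hne
    refine hc ⟨(u, v), hne⟩ ?_
    dsimp only at huv ⊢
    linarith
  obtain ⟨p, hp, hpv, -⟩ := exists_interpolation hinj fun v => -P v 1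
  refine ⟨(horizontalShear (fun y => c * y) (by fun_prop)).trans (verticalShear p hp), fun v => ?_⟩
  simp [verticalShear_apply, horizontalShear_apply, hpv]

theorem isClosed_segment (p q : Plane) : IsClosed (segment ℝ p q) := by
  rw [← Path.range_segment]
  exact (isCompact_range (Path.segment p q).continuous).isClosed

/-- A planar graph has a planar drawing in which the vertices and the edges of a given subgraph
whose components are paths lie on the axis. -/
theorem exists_axis_drawing {V : Type*} [Finite V] {G : SimpleGraph V} (hG : IsPlanarGraph G)
    (F : SimpleGraph V) : F ≤ G → F.IsAcyclic →
    (∀ v a b c, F.Adj v a → F.Adj v b → F.Adj v c → a = b ∨ a = c ∨ b = c) →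
    ∃ Γ : GraphDrawing G, Γ.IsPlanar ∧ (∀ v, Γ.pos v 1 = 0) ∧
      ∀ u v, F.Adj u v → Γ.edge s(u, v) = segment ℝ (Γ.pos u) (Γ.pos v) := by
  classical
  induction F using WellFoundedLT.induction with
  | ind F ih =>
  intro hFG hF hdeg
  by_cases hbot : F = ⊥
  · obtain ⟨Γ, hΓ⟩ := hG
    obtain ⟨h, hh⟩ := exists_points_to_axis Γ.pos_injective
    exact ⟨Γ.map h, hΓ.map h, hh, fun u v huv => by simp [hbot] at huv⟩
  obtain ⟨u, w, huw, hleaf⟩ := exists_leaf hF hbot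
  set F' := F.deleteEdges {s(u, w)} with hF'
  have hF'F : F' ≤ F := F.deleteEdges_le _
  have hF'adj : ∀ a b, F'.Adj a b ↔ F.Adj a b ∧ s(a, b) ≠ s(u, w) := fun a b => by
    simp [hF', SimpleGraph.deleteEdges_adj]
  have hlt : F' < F := lt_of_le_of_ne hF'F fun heq => by
    have : F'.Adj u w := heq ▸ huw
    exact ((hF'adj u w).mp this).2 rfl
  have hu' : ∀ a, ¬ F'.Adj u a := fun a ha => by
    obtain ⟨h1, h2⟩ := (hF'adj u a).mp ha
    exact h2 (by rw [hleaf a h1])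
  obtain ⟨Γ₀, hΓ₀, hax₀, hseg₀⟩ := ih F' hlt (hF'F.trans hFG) (hF.anti hF'F)
    fun v a b c ha hb hc => hdeg v a b c (hF'F ha) (hF'F hb) (hF'F hc)
  obtain ⟨Γ, hΓ, hpos, hseg, hpoly⟩ := hΓ₀.exists_polygonal hseg₀
  rw [← hpos] at hseg hpoly hax₀
  set P := Γ.pos with hP
  have hPi : Function.Injective P := Γ.pos_injective
  have hCpoly := hpoly w u (hFG huw.symm)
  set C := Γ.edge s(w, u) with hC
  -- `K` is what must not move: all vertices but the leaf, and the edges already on the axis. `K₀`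
  -- is its part away from `w`, so a ball around `P w` avoids it.
  set K : Set Plane := P '' {x | x ≠ u} ∪ ⋃ x ∈ {x : V × V | F'.Adj x.1 x.2},
    segment ℝ (P x.1) (P x.2) with hK
  set K₀ : Set Plane := P '' {x | x ≠ w} ∪ ⋃ x ∈ {x : V × V | F'.Adj x.1 x.2 ∧ x.1 ≠ w ∧ x.2 ≠ w},
    segment ℝ (P x.1) (P x.2) with hK₀
  have hKclosed : IsClosed K := (Set.toFinite _).isClosed.union
    (Set.Finite.isClosed_biUnion (Set.toFinite _) fun x _ => isClosed_segment _ _)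
  have hK₀closed : IsClosed K₀ := (Set.toFinite _).isClosed.union
    (Set.Finite.isClosed_biUnion (Set.toFinite _) fun x _ => isClosed_segment _ _)
  have hGadj : ∀ {a b}, F'.Adj a b → s(a, b) ∈ G.edgeSet := fun h => hFG (hF'F h)
  have hCK : C \ {P w} ⊆ Kᶜ := by
    rintro x ⟨hxC, hxw⟩ (⟨v, hv, rfl⟩ | hx)
    · have := Γ.mem_of_pos_mem_edge s(w, u) (hFG huw.symm) v hxC
      rcases Sym2.mem_iff.mp this with rfl | rfl
      · exact hxw rfl
      · exact hv rfl
    · obtain ⟨⟨a, b⟩, hab, hx⟩ := Set.mem_iUnion₂.mp hx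
      rw [← hseg a b hab] at hx
      obtain ⟨v, hv1, hv2, rfl⟩ := hΓ.exists_pos_of_mem (hFG huw.symm) (hGadj hab)
        (fun h => ((hF'adj a b).mp hab).2 (h.symm.trans Sym2.eq_swap)) hxC hx
      rcases Sym2.mem_iff.mp hv1 with rfl | rfl
      · exact hxw rfl
      · rcases Sym2.mem_iff.mp hv2 with rfl | rfl
        · exact hu' _ hab
        · exact hu' _ (F'.adj_symm hab)
  have hwK₀ : P w ∈ K₀ᶜ := by
    rintro (⟨v, hv, hvw⟩ | hx)
    · exact hv (hPi hvw)
    · obtain ⟨⟨a, b⟩, ⟨hab, haw, hbw⟩, hx⟩ := Set.mem_iUnion₂.mp hx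
      rw [← hseg a b hab] at hx
      rcases Sym2.mem_iff.mp (Γ.mem_of_pos_mem_edge _ (hGadj hab) w hx) with rfl | rfl
      · exact haw rfl
      · exact hbw rfl
  obtain ⟨R, hR, hRK⟩ := Metric.isOpen_iff.mp hK₀closed.isOpen_compl _ hwK₀
  obtain ⟨h, hfix, t, htw, htR, -, him⟩ := hCpoly.exists_contraction hKclosed.isOpen_compl hCK
    (ε := R / 4) (by linarith)
  have hfixK : ∀ z ∈ K, h z = z := fun z hz => hfix z fun h' => h' hz
  -- By the degree bound at most one edge of `F'` is left at `w`. The direction `d` along the axis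
  -- points away from it, so it lies on the ray that `exists_straighten` fixes.
  obtain ⟨d, hd0, hd1, hd⟩ : ∃ d : Plane, d ≠ 0 ∧ d 1 = 0 ∧ ∀ y, F'.Adj w y →
      ∀ z ∈ segment ℝ (P w) (P y), ∃ s : ℝ, 0 ≤ s ∧ z = P w - s • d := by
    by_cases hy : ∃ y, F'.Adj w y
    · obtain ⟨y, hy⟩ := hy
      refine ⟨P w - P y, sub_ne_zero.mpr (hPi.ne hy.ne), by simp [hax₀], ?_⟩
      intro y' hy' z hz
      obtain rfl : y' = y := by
        rcases hdeg w u y y' huw.symm (hF'F hy) (hF'F hy') with rfl | rfl | h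
        · exact absurd (F'.adj_symm hy) (hu' w)
        · exact absurd (F'.adj_symm hy') (hu' w)
        · exact h.symm
      rw [segment_eq_image'] at hz
      obtain ⟨s, hs, rfl⟩ := hz
      exact ⟨s, hs.1, by module⟩
    · refine ⟨!₂[1, 0], fun h => ?_, by simp, fun y hy' => absurd ⟨y, hy'⟩ hy⟩
      have := congrArg (fun z : Plane => z 0) h
      simp at this
  have hg : ∃ g : Plane ≃ₜ Plane, (∀ z ∈ K, g z = z) ∧
      ∀ z ∈ segment ℝ (P w) t, (g z) 1 = 0 := by
    -- If the short segment is parallel to `d`, it already lies on the axis.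
    by_cases hdet : planeDet d (t - P w) = 0
    · obtain ⟨k, hk⟩ := exists_smul_of_planeDet_eq_zero hd0 hdet
      have ht1 : t 1 = 0 := by
        have : t = P w + k • d := by rw [← hk]; module
        rw [this]
        simp [hax₀, hd1]
      exact ⟨Homeomorph.refl _, fun _ _ => rfl, fun z hz =>
        apply_one_of_mem_segment (hax₀ w) ht1 hz⟩
    · have hdn : 0 < ‖d‖ := norm_pos_iff.mpr hd0
      set κ : ℝ := R / (16 * ‖d‖) with hκ
      have hκ0 : 0 < κ := by positivity
      have hdet' : planeDet (κ • d) (t - P w) ≠ 0 := by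
        have : planeDet (κ • d) (t - P w) = κ * planeDet d (t - P w) := by
          simp only [planeDet, PiLp.smul_apply, smul_eq_mul]
          ring
        rw [this]
        exact mul_ne_zero hκ0.ne' hdet
      have hun : ‖κ • d‖ = R / 16 := by
        rw [norm_smul, Real.norm_of_nonneg hκ0.le, hκ]
        field_simp
      obtain ⟨g, hg1, hg2, hg3⟩ := exists_straighten hdet' (R := R) (by rw [hun]; linarith)
      have hray : ∀ y, F'.Adj w y → ∀ z ∈ segment ℝ (P w) (P y), g z = z := by
        intro y hy z hz
        obtain ⟨s, hs, rfl⟩ := hd y hy z hz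
        have := hg2 (s / κ) (div_nonneg hs hκ0.le)
        rwa [smul_smul, div_mul_cancel₀ _ hκ0.ne'] at this
      have hgK₀ : ∀ z ∈ K₀, g z = z := fun z hz => hg1 z fun h' => hRK h' hz
      refine ⟨g, ?_, ?_⟩
      · rintro z (⟨v, hv, rfl⟩ | hz)
        · by_cases hvw : v = w
          · have := hg2 0 le_rfl
            rw [zero_smul, sub_zero] at this
            rw [hvw, this]
          · exact hgK₀ _ (Or.inl ⟨v, hvw, rfl⟩)
        · obtain ⟨⟨a, b⟩, hab, hzs⟩ := Set.mem_iUnion₂.mp hz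
          dsimp only at hab hzs
          by_cases haw : a = w
          · subst haw
            exact hray b hab z hzs
          by_cases hbw : b = w
          · subst hbw
            rw [segment_symm] at hzs
            exact hray a (F'.adj_symm hab) z hzs
          · exact hgK₀ _ (Or.inr (Set.mem_biUnion (x := (a, b)) ⟨hab, haw, hbw⟩ hzs))
      · intro z hz
        have : g z ∈ segment ℝ (P w) (P w + κ • d) := hg3 ▸ ⟨z, hz, rfl⟩
        exact apply_one_of_mem_segment (hax₀ w) (by simp [hax₀, hd1]) this
  obtain ⟨g, hgK, hgt⟩ := hg
  have hHK : ∀ z ∈ K, (h.trans g) z = z := fun z hz => by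
    rw [Homeomorph.trans_apply, hfixK z hz, hgK z hz]
  have hHC : ∀ z ∈ C, ((h.trans g) z) 1 = 0 := fun z hz =>
    hgt _ (him ▸ ⟨z, hz, rfl⟩)
  refine ⟨Γ.map (h.trans g), hΓ.map _, ?_, ?_⟩
  · intro v
    by_cases hv : v = u
    · rw [hv]
      exact hHC _ hCpoly.isArc.right_mem
    · change ((h.trans g) (P v)) 1 = 0
      rw [hHK _ (Or.inl ⟨v, hv, rfl⟩)]
      exact hax₀ v
  · intro a b hab
    refine ((Γ.map (h.trans g)).isArc_edge a b (hFG hab)).eq_segment_of_axis ?_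
    rintro _ ⟨z, hz, rfl⟩
    by_cases hab' : F'.Adj a b
    · rw [hseg a b hab'] at hz
      rw [hHK z (Or.inr (Set.mem_biUnion (x := (a, b)) hab' hz))]
      exact apply_one_of_mem_segment (hax₀ a) (hax₀ b) hz
    · have he : s(a, b) = s(u, w) := by
        by_contra hne
        exact hab' ((hF'adj a b).mpr ⟨hab, hne⟩)
      rw [he, Sym2.eq_swap] at hz
      exact hHC z hz

/-! ### Drawings with prescribed vertices -/

theorem eq_axis_point {z : Plane} (h : z 1 = 0) : z = !₂[z 0, 0] :=
  plane_ext (by simp) (by simp [h])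

/-- An edge passes through no third vertex, so a straight edge on the axis joins consecutive
vertices. -/
theorem GraphDrawing.noneBetween {V : Type*} {G : SimpleGraph V} (Γ : GraphDrawing G)
    (hax : ∀ v, Γ.pos v 1 = 0) {u v : V} (huv : G.Adj u v)
    (hseg : Γ.edge s(u, v) = segment ℝ (Γ.pos u) (Γ.pos v)) :
    NoneBetween (fun x => Γ.pos x 0) u v := by
  have key : ∀ x, Γ.pos x 0 ∈ Set.uIcc (Γ.pos u 0) (Γ.pos v 0) → x = u ∨ x = v := by
    intro x hx
    have := mem_segment_of_apply_zero (hax u) (hax v) (hax x) hx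
    rw [← hseg] at this
    exact Sym2.mem_iff.mp (Γ.mem_of_pos_mem_edge _ huv x this)
  intro x
  constructor
  · rintro ⟨h1, h2⟩
    rcases key x (Set.mem_uIcc.mpr (Or.inl ⟨h1.le, h2.le⟩)) with rfl | rfl
    · exact lt_irrefl _ h1
    · exact lt_irrefl _ h2
  · rintro ⟨h1, h2⟩
    rcases key x (Set.mem_uIcc.mpr (Or.inr ⟨h1.le, h2.le⟩)) with rfl | rfl
    · exact lt_irrefl _ h2
    · exact lt_irrefl _ h1

theorem GraphDrawing.axis_injective {V : Type*} {G : SimpleGraph V} (Γ : GraphDrawing G)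
    (hax : ∀ v, Γ.pos v 1 = 0) : Function.Injective fun v => Γ.pos v 0 := fun u v huv =>
  Γ.pos_injective (plane_ext huv ((hax u).trans (hax v).symm))

/-- A planar graph has a polygonal planar drawing with prescribed vertices on the axis, in which
the edges of a given subgraph whose components are paths are straight. -/
theorem exists_polygonal_drawing_at {V : Type*} [Finite V] {G F : SimpleGraph V}
    (hG : IsPlanarGraph G) (hFG : F ≤ G) (hF : F.IsAcyclic)
    (hdeg : ∀ v a b c, F.Adj v a → F.Adj v b → F.Adj v c → a = b ∨ a = c ∨ b = c)
    {σ : V → ℝ} (hσ : Function.Injective σ) (hσF : ∀ u v, F.Adj u v → NoneBetween σ u v) :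
    ∃ Γ : GraphDrawing G, Γ.IsPlanar ∧ (∀ v, Γ.pos v = !₂[σ v, 0]) ∧
      (∀ u v, F.Adj u v → Γ.edge s(u, v) = segment ℝ !₂[σ u, 0] !₂[σ v, 0]) ∧
      ∀ u v, G.Adj u v → PolygonalArc (Γ.pos u) (Γ.pos v) (Γ.edge s(u, v)) := by
  obtain ⟨Γ₀, hΓ₀, hax₀, hseg₀⟩ := exists_axis_drawing hG F hFG hF hdeg
  obtain ⟨h, hh, hhs⟩ := exists_axis_permutation (Γ₀.axis_injective hax₀) hσ
  have hpos : ∀ v, (Γ₀.map h).pos v = !₂[σ v, 0] := fun v => by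
    rw [← hh, ← eq_axis_point (hax₀ v)]
    rfl
  have hseg : ∀ u v, F.Adj u v → (Γ₀.map h).edge s(u, v) =
      segment ℝ ((Γ₀.map h).pos u) ((Γ₀.map h).pos v) := by
    intro u v huv
    refine ((Γ₀.map h).isArc_edge u v (hFG huv)).eq_segment_of_axis ?_
    rintro _ ⟨z, hz, rfl⟩
    refine hhs u v (Γ₀.noneBetween hax₀ (hFG huv) (hseg₀ u v huv)) (hσF u v huv) z ?_
    rw [← eq_axis_point (hax₀ u), ← eq_axis_point (hax₀ v), ← hseg₀ u v huv]
    exact hz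
  obtain ⟨Γ, hΓ, hp, hs, hpoly⟩ := (hΓ₀.map h).exists_polygonal hseg
  refine ⟨Γ, hΓ, fun v => by rw [hp, hpos], fun u v huv => ?_, fun u v huv => ?_⟩
  · rw [hs u v huv, hpos, hpos]
  · rw [hp]
    exact hpoly u v huv

/-! ### Making the edges of two drawings meet finitely often -/

/-- The triple of coefficients `(a, b, c)` describes a line `a x + b y = c` through `z`. -/
def OnLine (l : ℝ × ℝ × ℝ) (z : Plane) : Prop := l.1 * z 0 + l.2.1 * z 1 = l.2.2

theorem PolygonalArc.exists_lines {p q : Plane} {C : Set Plane} (hC : PolygonalArc p q C) :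
    ∃ L : Set (ℝ × ℝ × ℝ), L.Finite ∧ (∀ l ∈ L, l.1 ≠ 0 ∨ l.2.1 ≠ 0) ∧
      ∀ z ∈ C, ∃ l ∈ L, OnLine l z := by
  have hline : ∀ {p q : Plane}, p ≠ q → ∃ l : ℝ × ℝ × ℝ, (l.1 ≠ 0 ∨ l.2.1 ≠ 0) ∧
      ∀ z ∈ segment ℝ p q, OnLine l z := by
    intro p q hpq
    refine ⟨(-(q 1 - p 1), q 0 - p 0, -(q 1 - p 1) * p 0 + (q 0 - p 0) * p 1), ?_, ?_⟩
    · by_contra hcon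
      push Not at hcon
      refine hpq (plane_ext ?_ ?_) <;> linarith [hcon.1, hcon.2]
    · intro z hz
      rw [segment_eq_image'] at hz
      obtain ⟨t, -, rfl⟩ := hz
      simp only [OnLine, PiLp.add_apply, PiLp.smul_apply, PiLp.sub_apply, smul_eq_mul]
      ring
  induction hC with
  | single h =>
    obtain ⟨l, hl, hl'⟩ := hline h
    exact ⟨{l}, Set.finite_singleton l, by simpa using hl, fun z hz => ⟨l, rfl, hl' z hz⟩⟩
  | cons h _ _ ih =>
    obtain ⟨l, hl, hl'⟩ := hline h
    obtain ⟨L, hL, hL', hL''⟩ := ih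
    refine ⟨insert l L, hL.insert l, ?_, ?_⟩
    · rintro _ (rfl | h)
      · exact hl
      · exact hL' _ h
    · rintro z (hz | hz)
      · exact ⟨l, Or.inl rfl, hl' z hz⟩
      · obtain ⟨l', h1, h2⟩ := hL'' z hz
        exact ⟨l', Or.inr h1, h2⟩

/-- The abscissas are roots of `Q`. If `b ≠ 0`, the leading term of `P` survives in `Q`, the other
terms having degree at most one; if `b = 0`, the line is vertical and the linear coefficient `a` is
nonzero. -/
theorem finite_line_inter_graph {l : ℝ × ℝ × ℝ} (hl : l.1 ≠ 0 ∨ l.2.1 ≠ 0)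
    {P : Polynomial ℝ} (hP : 2 ≤ P.natDegree) (m k : ℝ) :
    {z : Plane | OnLine l z ∧ z 1 = m * z 0 + k + P.eval (z 0)}.Finite := by
  obtain ⟨a, b, c⟩ := l
  dsimp only at hl
  open Polynomial in
  set Q : Polynomial ℝ := C a * X + C b * (C m * X + C k + P) - C c with hQ
  have hQ0 : Q ≠ 0 := by
    intro h0
    by_cases hb : b = 0
    · have h1 := congrArg (fun R => Polynomial.coeff R 1) h0
      simp [hQ, hb, Polynomial.coeff_C] at h1
      exact hl.resolve_right (by simp [hb]) h1
    · have h1 := congrArg (fun R => Polynomial.coeff R P.natDegree) h0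
      have e1 : P.natDegree ≠ 0 := by omega
      have e2 : 1 ≠ P.natDegree := by omega
      have e3 : P ≠ 0 := by
        rintro rfl
        simp at hP
      simp [hQ, hb, Polynomial.coeff_C, Polynomial.coeff_X, e1, e2, e3] at h1
  refine ((Q.roots.toFinset.finite_toSet).image
    fun x => (!₂[x, m * x + k + P.eval x] : Plane)).subset ?_
  rintro z ⟨hz, hz'⟩
  refine ⟨z 0, ?_, plane_ext (by simp) (by simp [hz'])⟩
  rw [Finset.mem_coe, Multiset.mem_toFinset, Polynomial.mem_roots hQ0]
  simp only [OnLine, hz'] at hz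
  simp only [hQ, Polynomial.IsRoot, Polynomial.eval_sub, Polynomial.eval_add, Polynomial.eval_mul,
    Polynomial.eval_C, Polynomial.eval_X]
  linarith

/-- A finite family of lines becomes a family of graphs of polynomials of high degree under a
homeomorphism that fixes given points of the axis. -/
theorem exists_bending {V : Type*} [Finite V] (σ : V → ℝ) {L : Set (ℝ × ℝ × ℝ)} (hL : L.Finite)
    (hL' : ∀ l ∈ L, l.1 ≠ 0 ∨ l.2.1 ≠ 0) : ∃ h : Plane ≃ₜ Plane,
      (∀ v, h !₂[σ v, 0] = !₂[σ v, 0]) ∧ ∀ l ∈ L, ∀ l' : ℝ × ℝ × ℝ, (l'.1 ≠ 0 ∨ l'.2.1 ≠ 0) →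
        {z | OnLine l' z ∧ ∃ y, OnLine l y ∧ h y = z}.Finite := by
  have := Fintype.ofFinite V
  have := hL.to_subtype
  -- After the horizontal shear by `c` no line of `L` is vertical, so each is the graph of an affine
  -- function.
  obtain ⟨c, hc⟩ := exists_shear_coefficient (ι := L) (fun l => l.1.2.1) (fun l => -l.1.1)
    (fun l => (hL' l.1 l.2).symm.imp id neg_ne_zero.mpr)
  open Polynomial in
  -- The product keeps the vertices fixed; the factor `X ^ 2` gives degree at least two for any
  -- number of vertices.
  set P : Polynomial ℝ := X ^ 2 * ∏ v : V, (X - C (σ v)) with hP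
  have hPm : (∏ v : V, (Polynomial.X - Polynomial.C (σ v))).Monic :=
    Polynomial.monic_prod_of_monic _ _ fun v _ => Polynomial.monic_X_sub_C (σ v)
  have hdeg : 2 ≤ P.natDegree := by
    rw [hP, (Polynomial.monic_X_pow 2).natDegree_mul hPm, Polynomial.natDegree_X_pow]
    exact Nat.le_add_right _ _
  have hroot : ∀ v, P.eval (σ v) = 0 := fun v => by
    rw [hP, Polynomial.eval_mul, Polynomial.eval_prod,
      Finset.prod_eq_zero (Finset.mem_univ v) (by simp), mul_zero]
  refine ⟨(horizontalShear (fun y => c * y) (by fun_prop)).trans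
    (verticalShear (fun x => P.eval x) P.continuous), fun v => ?_, fun l hl l' hl' => ?_⟩
  · simp [verticalShear_apply, horizontalShear_apply, hroot]
  · have hne : l.2.1 - c * l.1 ≠ 0 := by
      have := hc ⟨l, hl⟩
      dsimp only at this
      rwa [mul_neg, ← sub_eq_add_neg] at this
    refine (finite_line_inter_graph hl' hdeg (-l.1 / (l.2.1 - c * l.1))
      (l.2.2 / (l.2.1 - c * l.1))).subset ?_
    rintro z ⟨hz, y, hy, rfl⟩
    refine ⟨hz, ?_⟩
    simp only [OnLine] at hy
    simp only [Homeomorph.trans_apply, verticalShear_apply, horizontalShear_apply,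
      PiLp.toLp_apply, Matrix.cons_val_zero, Matrix.cons_val_one]
    congr 1
    rw [div_mul_eq_mul_div, ← add_div, eq_div_iff hne]
    linarith

theorem exists_finite_inter {V : Type*} [Finite V] {G : SimpleGraph V} {Γ : GraphDrawing G}
    (hΓ : Γ.IsPlanar) {σ : V → ℝ} (hpos : ∀ v, Γ.pos v = !₂[σ v, 0])
    (hpoly : ∀ u v, G.Adj u v → PolygonalArc (Γ.pos u) (Γ.pos v) (Γ.edge s(u, v))) :
    ∃ Γ' : GraphDrawing G, Γ'.IsPlanar ∧ (∀ v, Γ'.pos v = !₂[σ v, 0]) ∧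
      ∀ e ∈ G.edgeSet, ∀ {p q : Plane} {C : Set Plane}, PolygonalArc p q C →
        (Γ'.edge e ∩ C).Finite := by
  have hlines : ∀ e : Sym2 V, ∃ L : Set (ℝ × ℝ × ℝ), L.Finite ∧
      (∀ l ∈ L, l.1 ≠ 0 ∨ l.2.1 ≠ 0) ∧ (e ∈ G.edgeSet → ∀ z ∈ Γ.edge e, ∃ l ∈ L, OnLine l z) := by
    intro e
    by_cases he : e ∈ G.edgeSet
    · induction e with
      | _ u v =>
        obtain ⟨L, h1, h2, h3⟩ := (hpoly u v he).exists_lines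
        exact ⟨L, h1, h2, fun _ => h3⟩
    · exact ⟨∅, Set.finite_empty, by simp, fun h => absurd h he⟩
  choose L hL1 hL2 hL3 using hlines
  obtain ⟨h, hh, hfin⟩ := exists_bending σ (L := ⋃ e, L e) (Set.finite_iUnion hL1) fun l hl => by
    obtain ⟨e, he⟩ := Set.mem_iUnion.mp hl
    exact hL2 e l he
  refine ⟨Γ.map h, hΓ.map h, fun v => ?_, fun e he p q C hC => ?_⟩
  · exact (congrArg h (hpos v)).trans (hh v)
  · obtain ⟨L', hL'1, hL'2, hL'3⟩ := hC.exists_lines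
    refine (Set.Finite.biUnion (hL1 e) fun l hl => Set.Finite.biUnion hL'1 fun l' hl' =>
      hfin l (Set.mem_iUnion.mpr ⟨e, hl⟩) l' (hL'2 l' hl')).subset ?_
    rintro _ ⟨⟨y, hy, rfl⟩, hyC⟩
    obtain ⟨l, hl, hly⟩ := hL3 e he y hy
    obtain ⟨l', hl', hly'⟩ := hL'3 _ hyC
    exact Set.mem_biUnion hl (Set.mem_biUnion hl' ⟨hly', y, hly, rfl⟩)

/-! ### Overlaying two planar drawings -/

open Classical in
/-- The union of a drawing of `H` and a drawing of `G \ H` with the same vertices. -/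
noncomputable def GraphDrawing.overlay {V : Type*} {G H : SimpleGraph V} (Γ : GraphDrawing H)
    (Δ : GraphDrawing (G \ H)) (hpos : Δ.pos = Γ.pos)
    (hfin : ∀ e ∈ H.edgeSet, ∀ f ∈ (G \ H).edgeSet, (Γ.edge e ∩ Δ.edge f).Finite) :
    GraphDrawing G where
  pos := Γ.pos
  edge e := if e ∈ H.edgeSet then Γ.edge e else Δ.edge e
  pos_injective := Γ.pos_injective
  isArc_edge u v huv := by
    split_ifs with h
    · exact Γ.isArc_edge u v h
    · rw [← hpos]
      exact Δ.isArc_edge u v ⟨huv, h⟩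
  mem_of_pos_mem_edge e he w hw := by
    split_ifs at hw with h
    · exact Γ.mem_of_pos_mem_edge e h w hw
    · refine Δ.mem_of_pos_mem_edge e ?_ w (hpos ▸ hw)
      rw [SimpleGraph.edgeSet_sdiff]
      exact ⟨he, h⟩
  finite_inter e he f hf hef := by
    have hmem : ∀ e ∈ G.edgeSet, e ∉ H.edgeSet → e ∈ (G \ H).edgeSet := fun e he h => by
      rw [SimpleGraph.edgeSet_sdiff]
      exact ⟨he, h⟩
    split_ifs with h1 h2 h2
    · exact Γ.finite_inter e h1 f h2 hef
    · exact hfin e h1 f (hmem f hf h2)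
    · rw [Set.inter_comm]
      exact hfin f h2 e (hmem e he h1)
    · exact Δ.finite_inter e (hmem e he h1) f (hmem f hf h2) hef

/-- Pigeonhole: two of any three edges belong to the same planar layer. -/
theorem GraphDrawing.overlay_isQuasiplanar {V : Type*} {G H : SimpleGraph V} {Γ : GraphDrawing H}
    {Δ : GraphDrawing (G \ H)} (hΓ : Γ.IsPlanar) (hΔ : Δ.IsPlanar) (hpos : Δ.pos = Γ.pos)
    (hfin : ∀ e ∈ H.edgeSet, ∀ f ∈ (G \ H).edgeSet, (Γ.edge e ∩ Δ.edge f).Finite) :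
    (Γ.overlay Δ hpos hfin).IsQuasiplanar := by
  have h1 : ∀ e f, e ∈ H.edgeSet → f ∈ H.edgeSet → e ≠ f →
      ¬ (Γ.overlay Δ hpos hfin).Cross e f := by
    rintro e f he hf hef ⟨x, hxe, hxf, hx⟩
    refine hΓ e he f hf hef ⟨x, ?_, ?_, hx⟩
    · simpa [overlay, he] using hxe
    · simpa [overlay, hf] using hxf
  have h2 : ∀ e f, e ∈ G.edgeSet → f ∈ G.edgeSet → e ∉ H.edgeSet → f ∉ H.edgeSet → e ≠ f →
      ¬ (Γ.overlay Δ hpos hfin).Cross e f := by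
    rintro e f he hf he' hf' hef ⟨x, hxe, hxf, hx⟩
    refine hΔ e ?_ f ?_ hef ⟨x, ?_, ?_, hpos ▸ hx⟩
    · rw [SimpleGraph.edgeSet_sdiff]
      exact ⟨he, he'⟩
    · rw [SimpleGraph.edgeSet_sdiff]
      exact ⟨hf, hf'⟩
    · simpa [overlay, he'] using hxe
    · simpa [overlay, hf'] using hxf
  rintro e he f hf g hg hef heg hfg ⟨hc1, hc2, hc3⟩
  by_cases he' : e ∈ H.edgeSet <;> by_cases hf' : f ∈ H.edgeSet <;>
    by_cases hg' : g ∈ H.edgeSet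
  · exact h1 e f he' hf' hef hc1
  · exact h1 e f he' hf' hef hc1
  · exact h1 e g he' hg' heg hc2
  · exact h2 f g hf hg hf' hg' hfg hc3
  · exact h1 f g hf' hg' hfg hc3
  · exact h2 e g he hg he' hg' heg hc2
  · exact h2 e f he hf he' hf' hef hc1
  · exact h2 e f he hf he' hf' hef hc1

theorem GraphDrawing.IsPlanar.isQuasiplanar {V : Type*} {G : SimpleGraph V} {Γ : GraphDrawing G}
    (hΓ : Γ.IsPlanar) : Γ.IsQuasiplanar :=
  fun e he f hf _ _ hef _ _ hc => hΓ e he f hf hef hc.1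

/-! ### The three simultaneous drawings -/

theorem eq_or_eq_of_maxDegree_le_two {V : Type*} [Fintype V] {F : SimpleGraph V}
    [DecidableRel F.Adj] (h : F.maxDegree ≤ 2) (v a b c : V) (ha : F.Adj v a) (hb : F.Adj v b)
    (hc : F.Adj v c) : a = b ∨ a = c ∨ b = c := by
  classical
  by_contra hcon
  push Not at hcon
  have hcard : ({a, b, c} : Finset V).card = 3 :=
    Finset.card_eq_three.mpr ⟨a, b, c, hcon.1, hcon.2.1, hcon.2.2, rfl⟩
  have hsub : ({a, b, c} : Finset V) ⊆ F.neighborFinset v := by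
    intro x hx
    simp only [Finset.mem_insert, Finset.mem_singleton] at hx
    rw [SimpleGraph.mem_neighborFinset]
    rcases hx with rfl | rfl | rfl <;> assumption
  have h1 := Finset.card_le_card hsub
  have h2 := F.degree_le_maxDegree v
  rw [SimpleGraph.card_neighborFinset_eq_degree] at h1
  omega

theorem corollary2 {V : Type*} [Fintype V] (G₁ G₂ G₃ : SimpleGraph V)
    [DecidableRel (exclusiveCommon G₁ G₂ G₃).Adj]
    (hG₁ : IsPlanarGraph G₁) (hG₂ : IsPlanarGraph G₂) (hG₃ : IsPlanarGraph G₃)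
    (hacyclic : (exclusiveCommon G₁ G₂ G₃).IsAcyclic)
    (hdegree : (exclusiveCommon G₁ G₂ G₃).maxDegree ≤ 2) :
    AdmitsQuaSEFE ![G₁, G₂, G₃] := by
  have hdeg := eq_or_eq_of_maxDegree_le_two hdegree
  have hF₁ : exclusiveCommon G₁ G₂ G₃ ≤ G₁ \ G₃ := sdiff_le_sdiff_right inf_le_left
  have hF₂ : exclusiveCommon G₁ G₂ G₃ ≤ G₂ \ G₃ := sdiff_le_sdiff_right inf_le_right
  -- This drawing only serves to fix common vertex positions in which neighbours in the exclusive
  -- common graph are consecutive.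
  obtain ⟨Γ₀, -, hax, hseg⟩ := exists_axis_drawing (hG₁.mono sdiff_le) _ hF₁ hacyclic hdeg
  set σ : V → ℝ := fun v => Γ₀.pos v 0
  have hσ : Function.Injective σ := Γ₀.axis_injective hax
  have hσF : ∀ u v, (exclusiveCommon G₁ G₂ G₃).Adj u v → NoneBetween σ u v := fun u v huv =>
    Γ₀.noneBetween hax (hF₁ huv) (hseg u v huv)
  obtain ⟨Γ₁, hΓ₁, hpos₁, hseg₁, hpoly₁⟩ :=
    exists_polygonal_drawing_at (hG₁.mono sdiff_le) hF₁ hacyclic hdeg hσ hσF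
  obtain ⟨Γ₂, hΓ₂, hpos₂, hseg₂, hpoly₂⟩ :=
    exists_polygonal_drawing_at (hG₂.mono sdiff_le) hF₂ hacyclic hdeg hσ hσF
  -- No edge of `G₃` has to be straight, so its drawing may be bent to meet every polygonal arc
  -- finitely often.
  obtain ⟨Δ, hΔ, hposΔ, -, hpolyΔ⟩ := exists_polygonal_drawing_at (F := ⊥) hG₃ bot_le
    SimpleGraph.isAcyclic_bot (by simp) hσ (by simp)
  obtain ⟨Γ₃, hΓ₃, hpos₃, hfin⟩ := exists_finite_inter hΔ hposΔ hpolyΔ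
  have hfin₁ : ∀ e ∈ G₃.edgeSet, ∀ f ∈ (G₁ \ G₃).edgeSet, (Γ₃.edge e ∩ Γ₁.edge f).Finite := by
    intro e he f hf
    induction f with
    | _ u v => exact hfin e he (hpoly₁ u v hf)
  have hfin₂ : ∀ e ∈ G₃.edgeSet, ∀ f ∈ (G₂ \ G₃).edgeSet, (Γ₃.edge e ∩ Γ₂.edge f).Finite := by
    intro e he f hf
    induction f with
    | _ u v => exact hfin e he (hpoly₂ u v hf)
  have hpos₁₃ : Γ₁.pos = Γ₃.pos := funext fun v => (hpos₁ v).trans (hpos₃ v).symm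
  have hpos₂₃ : Γ₂.pos = Γ₃.pos := funext fun v => (hpos₂ v).trans (hpos₃ v).symm
  set Λ₁ := Γ₃.overlay Γ₁ hpos₁₃ hfin₁ with hΛ₁
  set Λ₂ := Γ₃.overlay Γ₂ hpos₂₃ hfin₂ with hΛ₂
  have h₁₃ : ∀ e ∈ G₃.edgeSet, Λ₁.edge e = Γ₃.edge e := fun e he => if_pos he
  have h₂₃ : ∀ e ∈ G₃.edgeSet, Λ₂.edge e = Γ₃.edge e := fun e he => if_pos he
  have h₁₂ : ∀ e ∈ G₁.edgeSet, e ∈ G₂.edgeSet → Λ₁.edge e = Λ₂.edge e := by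
    intro e he₁ he₂
    by_cases he₃ : e ∈ G₃.edgeSet
    · rw [h₁₃ e he₃, h₂₃ e he₃]
    · have e₁ : Λ₁.edge e = Γ₁.edge e := if_neg he₃
      have e₂ : Λ₂.edge e = Γ₂.edge e := if_neg he₃
      rw [e₁, e₂]
      -- The edge is common to `G₁` and `G₂` but not in `G₃`, so both layers draw it as the same
      -- segment of the axis.
      induction e with
      | _ u v =>
        have huv : (exclusiveCommon G₁ G₂ G₃).Adj u v := ⟨⟨he₁, he₂⟩, he₃⟩
        rw [hseg₁ u v huv, hseg₂ u v huv]
  refine ⟨Fin.cons Λ₁ (Fin.cons Λ₂ (Fin.cons Γ₃ finZeroElim)), ?_, ?_, ?_⟩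
  · intro i
    fin_cases i
    · exact GraphDrawing.overlay_isQuasiplanar hΓ₃ hΓ₁ hpos₁₃ hfin₁
    · exact GraphDrawing.overlay_isQuasiplanar hΓ₃ hΓ₂ hpos₂₃ hfin₂
    · exact hΓ₃.isQuasiplanar
  · intro i j v
    fin_cases i <;> fin_cases j <;> rfl
  · intro i j e he
    fin_cases i <;> fin_cases j
    · rfl
    · exact h₁₂ e he.1 he.2
    · exact h₁₃ e he.2
    · exact (h₁₂ e he.2 he.1).symm
    · rfl
    · exact h₂₃ e he.2
    · exact (h₁₃ e he.1).symm
    · exact (h₂₃ e he.1).symm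
    · rfl
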